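/- Let $\mathbb D$ be the open unit disk, $dA=\frac1\pi\,dx\,dy$, and let $L^2_a$ be the Bergman space of analytic functions in $L^2(\mathbb D,dA)$, with reproducing kernel $K_z(w)=(1-\bar z w)^{-2}$ and normalized kernel $k_z=K_z/\|K_z\|$. For a finite positive Borel measure $\mu$ on $\mathbb D$ put $$T_\mu f(z)=\int_{\mathbb D}\frac{f(w)}{(1-z\bar w)^2}\,d\mu(w),\qquad \widetilde\mu(z)=\int_{\mathbb D}|k_z(w)|^2\,d\mu(w),\qquad z\in\mathbb D .$$ For $R>0$, an $R$-lattice is a sequence $\{b_k\}_{k\ge1}$ of distinct points of $\mathbb D$ such that every $z\in\mathbb D$ satisfies $\beta(b_k,z)<R$ for some $k$, and $\beta(b_k,b_j)\ge R/2$ for $k\ne j$, where $\beta(z,w)=\tanh^{-1}\left|\frac{w-z}{1-\bar w z}\right|$ is the Bergman distance. **Theorem.** There is a finite positive Borel measure $\nu$ on $\mathbb D$ such that $T_\nu$ is a bounded operator on $L^2_a$ (with the defining integral absolutely convergent for all $f\in L^2_a$ and $z\in\mathbb D$) which is not invertible, although $\widetilde\nu$ is bounded below: $\widetilde\nu(z)\ge\delta$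 for some $\delta>0$ and all $z\in\mathbb D$. Thus a bounded Toeplitz operator on $L_a^2$ induced by a finite positive measure need not be invertible when its Berezin transform is bounded below, which answers the Douglas question for positive measures on the Bergman space in the negative. More precisely, there is $R_0>0$ such that for every $R\ge R_0$, $R$-lattices exist, and for every $R$-lattice $\{b_k\}$ the measure $\nu=\sum_{k}(1-|b_k|^2)^2\,\delta_{b_k}$ has all of these properties. -/

import Mathlib

open MeasureTheory
open scoped ComplexConjugate

noncomputable section

namespace Bergman

/-- The open unit disk, as a type, with its Borel sigma-algebra. -/
abbrev Disk : Type := Metric.ball (0 : ℂ) 1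

/-- Normalized area measure `dA = π⁻¹ dx dy` on the open unit disk. -/
def areaMeasure : Measure ℂ :=
  ENNReal.ofReal Real.pi⁻¹ • volume.restrict (Metric.ball (0 : ℂ) 1)

/-- The Bergman space: the subspace of `L²(𝔻, dA)` of those classes that have an analytic
representative on the disk, with the norm and inner product of `L²(𝔻, dA)`. -/
def BergmanSpace : Submodule ℂ (Lp ℂ 2 areaMeasure) where
  carrier := {f | ∃ g : ℂ → ℂ, DifferentiableOn ℂ g (Metric.ball 0 1) ∧ f =ᵐ[areaMeasure] g}
  add_mem' := by
    rintro f₁ f₂ ⟨g₁, hg₁, h₁⟩ ⟨g₂, hg₂, h₂⟩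
    exact ⟨g₁ + g₂, hg₁.add hg₂, (Lp.coeFn_add f₁ f₂).trans (h₁.add h₂)⟩
  zero_mem' := ⟨0, differentiableOn_const 0, Lp.coeFn_zero ℂ 2 areaMeasure⟩
  smul_mem' := by
    rintro c f ⟨g, hg, h⟩
    exact ⟨c • g, hg.const_smul c, (Lp.coeFn_smul c f).trans (h.const_smul c)⟩

/-- The value at the point `z` of the disk of (the analytic representative of) `f`. -/
def eval (f : BergmanSpace) (z : Disk) : ℂ := Classical.choose f.2 z

/-- The analytic representative is unique on the disk, so that `eval` is the value of any one. -/
theorem eval_eq (f : BergmanSpace) {g : ℂ → ℂ} (hg : DifferentiableOn ℂ g (Metric.ball 0 1))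
    (h : (f : Lp ℂ 2 areaMeasure) =ᵐ[areaMeasure] g) (z : Disk) : eval f z = g z := by
  obtain ⟨hc, hf⟩ := Classical.choose_spec f.2
  have h1 : Classical.choose f.2 =ᵐ[areaMeasure] g := hf.symm.trans h
  have hpi : ENNReal.ofReal Real.pi⁻¹ ≠ 0 := by simp [Real.pi_pos]
  have h2 : Classical.choose f.2 =ᵐ[volume.restrict (Metric.ball (0 : ℂ) 1)] g :=
    (Measure.ae_ennreal_smul_measure_iff hpi).1 h1
  exact Measure.eqOn_open_of_ae_eq h2 Metric.isOpen_ball hc.continuousOn hg.continuousOn z.2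

/-- The reproducing kernel `K_z(w) = (1 - z̄ w)⁻²`. -/
def kernel (z : Disk) (w : ℂ) : ℂ := 1 / (1 - conj (z : ℂ) * w) ^ 2

/-- The normalized reproducing kernel `k_z = K_z / ‖K_z‖`, with the norm of `L²(𝔻, dA)`. -/
def normalizedKernel (z : Disk) (w : ℂ) : ℂ :=
  kernel z w / (Real.sqrt (∫ u, ‖kernel z u‖ ^ 2 ∂areaMeasure) : ℝ)

/-- The Berezin transform `z ↦ ∫ |k_z|² dμ` of a measure on the disk. -/
def berezin (μ : Measure Disk) (z : Disk) : ℝ :=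
  ∫ w : Disk, ‖normalizedKernel z w‖ ^ 2 ∂μ

/-- `T` is the Toeplitz operator of `μ`, as a bounded operator on the Bergman space: for every `f`
in the Bergman space and every `z` in the disk the integral `∫ f(w) (1 - z w̄)⁻² dμ(w)` converges
absolutely, and its value is `(T f)(z)`. -/
def IsToeplitzOperator (μ : Measure Disk) (T : BergmanSpace →L[ℂ] BergmanSpace) : Prop :=
  ∀ (f : BergmanSpace) (z : Disk),
    Integrable (fun w : Disk => eval f w / (1 - (z : ℂ) * conj (w : ℂ)) ^ 2) μ ∧
    eval (T f) z = ∫ w : Disk, eval f w / (1 - (z : ℂ) * conj (w : ℂ)) ^ 2 ∂μ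

/-- The pseudo-hyperbolic distance `ρ(z, w) = |(w - z) / (1 - w̄ z)|`. -/
def pseudoDist (z w : Disk) : ℝ := ‖((w : ℂ) - z) / (1 - conj (w : ℂ) * z)‖

/-- The Bergman distance `β = artanh ρ`. -/
def bergmanDist (z w : Disk) : ℝ := Real.artanh (pseudoDist z w)

/-- An `R`-lattice: a sequence of distinct points of the disk, any two of them at Bergman distance
at least `R / 2`, whose Bergman disks of radius `R` cover the disk. -/
def IsLattice (R : ℝ) (b : ℕ → Disk) : Prop :=
  Function.Injective b ∧ (∀ z : Disk, ∃ k, bergmanDist (b k) z < R) ∧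
    ∀ j k, j ≠ k → R / 2 ≤ bergmanDist (b k) (b j)

/-- The measure `∑ₖ (1 - |bₖ|²)² δ_{bₖ}` on the disk. -/
def latticeMeasure (b : ℕ → Disk) : Measure Disk :=
  Measure.sum fun k => ENNReal.ofReal ((1 - ‖(b k : ℂ)‖ ^ 2) ^ 2) • Measure.dirac (b k)

/-- The measure `μ` answers the Douglas question negatively: it is finite, its Toeplitz operator
is bounded but not invertible, and its Berezin transform is bounded below by a positive constant. -/
def IsDouglasCounterexample (μ : Measure Disk) : Prop :=
  IsFiniteMeasure μ ∧
  (∃ T : BergmanSpace →L[ℂ] BergmanSpace, IsToeplitzOperator μ T ∧ ¬ IsUnit T) ∧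
  ∃ δ : ℝ, 0 < δ ∧ ∀ z : Disk, δ ≤ berezin μ z

end Bergman

end

/-!
For a lattice `b` put `a k = 1 - |b k|²`. The Toeplitz operator of `∑ₖ (a k)² δ_{b k}` is `S* S`,
where `S f = (a k f(b k))ₖ` is the weighted restriction from the Bergman space to `ℓ²`. It is
bounded because the disks of radius `(1 - |b k|) / 4` around separated points are disjoint and `|f|²`
has the sub-mean-value property (`sum_weight_mul_eval_sq_le`); the formula for its values is the
reproducing property `inner_kernelElem`. The Berezin transform at `z` contains the term
`(1 - ρ(b k, z)²)²`, which is bounded below for the lattice point `b k` within Bergman distance `R`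
of `z` (`le_berezin_latticeMeasure`).

The operator is nevertheless not injective once `R` is large. The Gram matrix of the normalized
kernels `a k K_{b k}` has the entries `a j a k / |1 - conj (b j) (b k)|²` in modulus. The rows are not
summable, but in the Schur test with weights `√(a k)` they are: moving `b j` to the origin by a disk
automorphism turns a row into `∑ₖ (1 - |c k|²)^(3/2) / |1 - x c k|` over a separated family `c`, and
`∑ₖ (1 - |c k|)^(5/4) / |1 - x c k|` is bounded uniformly by comparison with an integral
(`exists_sum_weight_kernel_le`). The remaining factor `(1 - |c k|²)^(1/4)` is small, since all `|c k|`
are close to `1` for large separation (`exists_gram_schur_bound`). So the normalized kernels form a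
Riesz sequence (`riesz_lower_bound`), no kernel lies in the closed span of the others, and there is a
Bergman function `f` that vanishes at all `b k` with `k ≠ 0` but not at `b 0`. Then `(z - b 0) f` is a
nonzero Bergman function that vanishes on the whole lattice, and the operator maps it to `0`
(`not_isUnit_latticeToeplitz`).
-/

noncomputable section

namespace Bergman

open Set Metric Filter Topology
open scoped Real ENNReal

/-! ### Polar coordinates, mean values and the reproducing formula -/

theorem lintegral_ball_eq_polar {g : ℂ → ℝ≥0∞} (hg : Measurable g) (c : ℂ) (s : ℝ) :
    ∫⁻ w in ball c s, g w =
      ∫⁻ r in Ioo 0 s, ENNReal.ofReal r * ∫⁻ θ in Ioo (-π) π, g (circleMap c r θ) := by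
  have hind : Measurable fun p : ℝ × ℝ =>
      ENNReal.ofReal p.1 * (ball c s).indicator g (circleMap c p.1 p.2) := by
    refine (ENNReal.measurable_ofReal.comp measurable_fst).mul
      ((hg.indicator measurableSet_ball).comp ?_)
    unfold circleMap
    fun_prop
  have h1 : ∫⁻ w in ball c s, g w = ∫⁻ w, (ball c s).indicator g (c + w) := by
    rw [lintegral_add_left_eq_self (fun w => (ball c s).indicator g w) c,
      lintegral_indicator measurableSet_ball]
  have h2 : ∀ p : ℝ × ℝ, c + Complex.polarCoord.symm p = circleMap c p.1 p.2 := by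
    intro p
    simp [circleMap, Complex.exp_mul_I]
  rw [h1, ← Complex.lintegral_comp_polarCoord_symm]
  simp only [h2, smul_eq_mul, polarCoord_target]
  rw [Measure.volume_eq_prod, ← Measure.prod_restrict, lintegral_prod _ hind.aemeasurable]
  have h3 : ∀ r ∈ Ioi (0 : ℝ), (∫⁻ θ in Ioo (-π) π,
      ENNReal.ofReal r * (ball c s).indicator g (circleMap c r θ)) =
      (Iio s).indicator
        (fun r => ENNReal.ofReal r * ∫⁻ θ in Ioo (-π) π, g (circleMap c r θ)) r := by
    intro r hr
    rw [lintegral_const_mul' _ _ ENNReal.ofReal_ne_top]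
    by_cases h : r < s
    · rw [indicator_of_mem (show r ∈ Iio s from h)]
      congr 2 with θ
      rw [indicator_of_mem]
      simpa [dist_eq_norm, abs_of_pos (show 0 < r from hr)] using h
    · rw [indicator_of_notMem (show r ∉ Iio s from h)]
      have : ∀ θ, (ball c s).indicator g (circleMap c r θ) = 0 := by
        intro θ
        rw [indicator_of_notMem]
        simpa [dist_eq_norm, abs_of_pos (show 0 < r from hr)] using h
      simp [this]
  rw [setLIntegral_congr_fun measurableSet_Ioi h3, lintegral_indicator measurableSet_Iio,
    Measure.restrict_restrict measurableSet_Iio]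
  congr 2
  ext r
  simp [and_comm]

/-- The sub-mean-value property over a disk of the square of the modulus of an analytic function. -/
theorem sub_mean_value {f : ℂ → ℂ} {c : ℂ} {s : ℝ} (hs : 0 ≤ s)
    (hf : DifferentiableOn ℂ f (ball c s)) :
    ENNReal.ofReal (π * s ^ 2) * ‖f c‖ₑ ^ 2 ≤ ∫⁻ w in ball c s, ‖f w‖ₑ ^ 2 := by
  have hmeas : Measurable fun w => (ball c s).indicator (fun w => ‖f w‖ₑ ^ 2) w := by
    classical
    simp only [← piecewise_eq_indicator]
    refine ContinuousOn.measurable_piecewise ?_ continuousOn_const measurableSet_ball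
    exact (ENNReal.continuous_pow 2).comp_continuousOn hf.continuousOn.enorm
  have h0 : ∫⁻ w in ball c s, ‖f w‖ₑ ^ 2 =
      ∫⁻ w in ball c s, (ball c s).indicator (fun w => ‖f w‖ₑ ^ 2) w :=
    setLIntegral_congr_fun measurableSet_ball fun w hw => by
      simp only [indicator_of_mem hw]
  rw [h0, lintegral_ball_eq_polar hmeas]
  -- on each circle, the mean value property is applied to `f ^ 2`, which is analytic too
  have hcircle : ∀ r ∈ Ioo 0 s, ENNReal.ofReal r * (ENNReal.ofReal (2 * π) * ‖f c‖ₑ ^ 2) ≤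
      ENNReal.ofReal r * ∫⁻ θ in Ioo (-π) π,
        (ball c s).indicator (fun w => ‖f w‖ₑ ^ 2) (circleMap c r θ) := by
    intro r hr
    gcongr
    have hsub : closedBall c |r| ⊆ ball c s := by
      rw [abs_of_pos hr.1]
      exact closedBall_subset_ball hr.2
    have hmv : Real.circleAverage (fun w => f w ^ 2) c r = f c ^ 2 :=
      circleAverage_of_differentiable_on_off_countable countable_empty
        ((hf.pow 2).continuousOn.mono hsub) fun z hz =>
          (hf.pow 2).differentiableAt (isOpen_ball.mem_nhds (hsub (ball_subset_closedBall hz.1)))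
    have hper : ∫ θ in (-π)..π, f (circleMap c r θ) ^ 2 = 2 * π * f c ^ 2 := by
      rw [Real.circleAverage_def] at hmv
      have hp : Function.Periodic (fun θ => f (circleMap c r θ) ^ 2) (2 * π) := fun θ => by
        simp only [periodic_circleMap c r θ]
      have := hp.intervalIntegral_add_eq (-π) 0
      rw [zero_add, show -π + 2 * π = π by ring] at this
      rw [this, ← hmv]
      simp only [Complex.real_smul]
      push_cast
      field_simp
    have hnorm : ‖(2 * π * f c ^ 2 : ℂ)‖ₑ = ENNReal.ofReal (2 * π) * ‖f c‖ₑ ^ 2 := by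
      rw [enorm_mul, enorm_pow]
      congr 1
      rw [← ofReal_norm]
      simp [abs_of_pos Real.pi_pos]
    rw [← hnorm, ← hper, intervalIntegral.integral_of_le (by linarith [Real.pi_pos]),
      integral_Ioc_eq_integral_Ioo]
    refine (enorm_integral_le_lintegral_enorm _).trans (le_of_eq ?_)
    congr 1 with θ
    rw [indicator_of_mem, enorm_pow]
    simpa [dist_eq_norm, abs_of_pos hr.1] using hr.2
  refine le_trans ?_ (setLIntegral_mono' measurableSet_Ioo hcircle)
  rw [lintegral_mul_const _ ENNReal.measurable_ofReal, ← mul_assoc]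
  gcongr
  rw [← ofReal_integral_eq_lintegral_ofReal]
  · rw [← integral_Ioc_eq_integral_Ioo, ← intervalIntegral.integral_of_le hs, integral_id,
      ← ENNReal.ofReal_mul (by nlinarith)]
    exact ENNReal.ofReal_le_ofReal (by nlinarith)
  · exact (continuous_id.integrableOn_Icc (a := 0) (b := s)).mono_set Ioo_subset_Icc_self
  · exact (ae_restrict_mem measurableSet_Ioo).mono fun r hr => hr.1.le

theorem integral_ball_eq_polar {g : ℂ → ℂ} {s : ℝ} (hs : 0 ≤ s)
    (hg : ContinuousOn g (closedBall 0 s)) :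
    ∫ w in ball 0 s, g w = ∫ r in (0 : ℝ)..s, r * ∫ θ in (0 : ℝ)..2 * π, g (circleMap 0 r θ) := by
  have h2 : ∀ p : ℝ × ℝ, Complex.polarCoord.symm p = circleMap 0 p.1 p.2 := by
    intro p
    simp [circleMap, Complex.exp_mul_I]
  have hcm : Continuous fun p : ℝ × ℝ => circleMap 0 p.1 p.2 := by
    unfold circleMap
    fun_prop
  have hint : IntegrableOn (fun p : ℝ × ℝ => (p.1 : ℂ) * g (circleMap 0 p.1 p.2))
      (Ioo 0 s ×ˢ Ioo (-π) π) (volume.prod volume) := by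
    have hK : IsCompact (Icc (0 : ℝ) s ×ˢ Icc (-π) π) := isCompact_Icc.prod isCompact_Icc
    refine IntegrableOn.mono_set (ContinuousOn.integrableOn_compact hK ?_)
      (prod_mono Ioo_subset_Icc_self Ioo_subset_Icc_self)
    refine ContinuousOn.mul (by fun_prop) (hg.comp hcm.continuousOn ?_)
    rintro ⟨r, θ⟩ ⟨hr, -⟩
    simpa [dist_eq_norm, abs_of_nonneg hr.1] using hr.2
  rw [← integral_indicator measurableSet_ball, ← Complex.integral_comp_polarCoord_symm,
    polarCoord_target]
  have hsub : Ioo 0 s ×ˢ Ioo (-π) π ⊆ Ioi (0 : ℝ) ×ˢ Ioo (-π) π :=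
    prod_mono Ioo_subset_Ioi_self subset_rfl
  rw [setIntegral_eq_of_subset_of_forall_sdiff_eq_zero
    (measurableSet_Ioi.prod measurableSet_Ioo) hsub]
  · have h3 : ∀ p ∈ Ioo (0 : ℝ) s ×ˢ Ioo (-π) π,
        p.1 • (ball (0 : ℂ) s).indicator g (Complex.polarCoord.symm p) =
          (p.1 : ℂ) * g (circleMap 0 p.1 p.2) := by
      rintro ⟨r, θ⟩ ⟨hr, -⟩
      rw [h2, indicator_of_mem]
      · simp
      · simpa [dist_eq_norm, abs_of_pos hr.1] using hr.2
    rw [setIntegral_congr_fun (measurableSet_Ioo.prod measurableSet_Ioo) h3,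
      Measure.volume_eq_prod, setIntegral_prod _ hint, intervalIntegral.integral_of_le hs,
      integral_Ioc_eq_integral_Ioo]
    refine setIntegral_congr_fun measurableSet_Ioo fun r _ => ?_
    simp only
    rw [integral_const_mul]
    congr 1
    rw [← integral_Ioc_eq_integral_Ioo,
      ← intervalIntegral.integral_of_le (by linarith [Real.pi_pos])]
    have hp : Function.Periodic (fun θ => g (circleMap 0 r θ)) (2 * π) := fun θ => by
      simp only [periodic_circleMap 0 r θ]
    have := hp.intervalIntegral_add_eq (-π) 0
    rwa [zero_add, show -π + 2 * π = π by ring] at this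
  · rintro ⟨r, θ⟩ ⟨⟨hr, hθ⟩, h⟩
    rw [h2, indicator_of_notMem, smul_zero]
    simp only [mem_ball, dist_zero_right, norm_circleMap_zero, abs_of_pos (show 0 < r from hr)]
    exact fun hlt => h ⟨⟨hr, hlt⟩, hθ⟩

theorem norm_mul_conj_lt_one {z w : ℂ} (hz : ‖z‖ < 1) (hw : ‖w‖ ≤ 1) : ‖z * conj w‖ < 1 := by
  rw [norm_mul, RCLike.norm_conj]
  nlinarith [norm_nonneg z, norm_nonneg w]

theorem one_sub_ne_zero_of_norm_lt {u : ℂ} (hu : ‖u‖ < 1) : 1 - u ≠ 0 := by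
  intro h
  rw [← sub_eq_zero.1 h] at hu
  simp at hu

/-- On the circle of radius `r` one has `w̄ = r² / w`, which turns the integral against the
conjugate reproducing kernel into Cauchy's formula for the derivative of `w f(w)` at `r² z`. -/
theorem circle_reproducing {f : ℂ → ℂ} (hf : DifferentiableOn ℂ f (ball 0 1)) {z : ℂ}
    (hz : ‖z‖ < 1) {r : ℝ} (h0 : 0 < r) (h1 : r < 1) :
    ∫ θ in (0 : ℝ)..2 * π, f (circleMap 0 r θ) / (1 - z * conj (circleMap 0 r θ)) ^ 2 =
      2 * π * (f (r ^ 2 * z) + r ^ 2 * z * deriv f (r ^ 2 * z)) := by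
  set a : ℂ := r ^ 2 * z with ha
  have har : ‖a‖ < r := by
    rw [ha, norm_mul, norm_pow, Complex.norm_real, Real.norm_of_nonneg h0.le]
    nlinarith [norm_nonneg z, mul_pos h0 h0]
  have hamem : a ∈ ball (0 : ℂ) r := by simpa using har
  have hamem' : a ∈ ball (0 : ℂ) 1 := by simpa using har.trans h1
  have hd : deriv (fun w => w * f w) a = f a + a * deriv f a := by
    have h := (hasDerivAt_id a).mul
      (hf.differentiableAt (isOpen_ball.mem_nhds hamem')).hasDerivAt
    simpa using! h.deriv
  have hC := Complex.two_pi_I_inv_smul_circleIntegral_sub_sq_inv_smul_of_differentiable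
    (U := ball (0 : ℂ) 1) isOpen_ball (closedBall_subset_ball h1)
    (f := fun w => w * f w) (differentiableOn_id.mul hf) hamem
  have hpi : (2 * π * Complex.I : ℂ) ≠ 0 := Complex.two_pi_I_ne_zero
  rw [hd, smul_eq_mul, inv_mul_eq_iff_eq_mul₀ hpi, circleIntegral_def_Icc,
    integral_Icc_eq_integral_Ioc, ← intervalIntegral.integral_of_le (by positivity)] at hC
  -- with `w̄ = r² / w` on the circle, `1 - z w̄ = (w - a) / w`
  have hcongr : ∀ θ : ℝ, deriv (circleMap 0 r) θ •
      (((circleMap 0 r θ - a) ^ 2)⁻¹ • (circleMap 0 r θ * f (circleMap 0 r θ))) =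
      Complex.I * (f (circleMap 0 r θ) / (1 - z * conj (circleMap 0 r θ)) ^ 2) := by
    intro θ
    set w := circleMap 0 r θ with hw
    have hwn : ‖w‖ = r := by simp [hw, abs_of_pos h0]
    have hw0 : w ≠ 0 := by
      intro h
      rw [h, norm_zero] at hwn
      exact h0.ne hwn
    have hwa : w - a ≠ 0 := by
      intro h
      rw [sub_eq_zero.1 h] at hwn
      exact har.ne hwn
    have hww : conj w * w = r ^ 2 := by
      rw [mul_comm, Complex.mul_conj, Complex.normSq_eq_norm_sq, hwn]
      push_cast
      rfl
    have hden : (1 - z * conj w) * w = w - a := by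
      rw [ha, ← hww]
      ring
    have hne : 1 - z * conj w ≠ 0 := fun h => hwa (by rw [← hden, h, zero_mul])
    rw [deriv_circleMap, ← hw, ← hden, smul_eq_mul, smul_eq_mul]
    field_simp
  simp only [hcongr] at hC
  rw [intervalIntegral.integral_const_mul] at hC
  have := mul_left_cancel₀ Complex.I_ne_zero
    (hC.trans (show _ = Complex.I * (2 * π * (f a + a * deriv f a)) by ring))
  exact this

theorem continuousOn_conj_kernel_mul {f : ℂ → ℂ} {S : Set ℂ} (hf : ContinuousOn f S)
    (hS : S ⊆ closedBall 0 1) {z : ℂ} (hz : ‖z‖ < 1) :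
    ContinuousOn (fun w => f w / (1 - z * conj w) ^ 2) S := by
  refine hf.div ?_ fun w hw => pow_ne_zero 2 (one_sub_ne_zero_of_norm_lt
    (norm_mul_conj_lt_one hz (by simpa using hS hw)))
  exact ((continuous_const.sub (continuous_const.mul Complex.continuous_conj)).pow 2).continuousOn

/-- Integration over the radius of the circle formula, whose right-hand side is the derivative of
`π r² f(r² z)` in `r`. -/
theorem integral_ball_reproducing {f : ℂ → ℂ} (hf : DifferentiableOn ℂ f (ball 0 1)) {z : ℂ}
    (hz : ‖z‖ < 1) {s : ℝ} (h0 : 0 < s) (h1 : s < 1) :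
    ∫ w in ball 0 s, f w / (1 - z * conj w) ^ 2 = π * s ^ 2 * f (s ^ 2 * z) := by
  have hsub : closedBall (0 : ℂ) s ⊆ ball 0 1 := closedBall_subset_ball h1
  rw [integral_ball_eq_polar h0.le (continuousOn_conj_kernel_mul (hf.continuousOn.mono hsub)
    (hsub.trans ball_subset_closedBall) hz)]
  have hmem : ∀ r ∈ uIcc 0 s, (r : ℂ) ^ 2 * z ∈ ball (0 : ℂ) 1 := by
    intro r hr
    rw [uIcc_of_le h0.le] at hr
    have : r ^ 2 ≤ 1 := by nlinarith [hr.1, hr.2]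
    rw [mem_ball, dist_zero_right, norm_mul, norm_pow, Complex.norm_real,
      Real.norm_of_nonneg hr.1]
    nlinarith [norm_nonneg z, sq_nonneg r]
  have hderiv : ∀ r ∈ uIcc 0 s, HasDerivAt (fun r : ℝ => π * (r : ℂ) ^ 2 * f ((r : ℂ) ^ 2 * z))
      (r * (2 * π * (f (r ^ 2 * z) + r ^ 2 * z * deriv f (r ^ 2 * z)))) r := by
    intro r hr
    have hr1 : HasDerivAt (fun r : ℝ => (r : ℂ)) 1 r := Complex.ofRealCLM.hasDerivAt
    have hr2 := hr1.fun_pow 2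
    have hF := (hf.differentiableAt (isOpen_ball.mem_nhds (hmem r hr))).hasDerivAt
    have hcomp := HasDerivAt.comp r hF (hr2.mul_const z)
    refine ((hr2.const_mul (π : ℂ)).mul hcomp).congr_deriv ?_
    simp only [Function.comp_apply, Nat.cast_ofNat, Nat.add_one_sub_one, pow_one]
    ring
  have hcont : ContinuousOn
      (fun r : ℝ => (r : ℂ) * (2 * π * (f (r ^ 2 * z) + r ^ 2 * z * deriv f (r ^ 2 * z))))
      (uIcc 0 s) := by
    have hp : ContinuousOn (fun r : ℝ => (r : ℂ) ^ 2 * z) (uIcc 0 s) := by fun_prop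
    have hf1 := hf.continuousOn.comp hp hmem
    have hf2 := (hf.deriv isOpen_ball).continuousOn.comp hp hmem
    have hr1 : ContinuousOn (fun r : ℝ => (r : ℂ)) (uIcc 0 s) := by fun_prop
    exact hr1.mul (continuousOn_const.mul (hf1.add (hp.mul hf2)))
  rw [← sub_zero (π * (s : ℂ) ^ 2 * f (s ^ 2 * z))]
  have hftc := intervalIntegral.integral_eq_sub_of_hasDerivAt hderiv hcont.intervalIntegrable
  simp only [Complex.ofReal_zero, ne_eq, OfNat.ofNat_ne_zero, not_false_eq_true, zero_pow,
    mul_zero, zero_mul] at hftc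
  rw [← hftc]
  refine intervalIntegral.integral_congr_ae ?_
  refine .of_forall fun r hr => ?_
  rw [uIoc_of_le h0.le] at hr
  rw [circle_reproducing hf hz hr.1 (hr.2.trans_lt h1)]

/-- The reproducing formula of the Bergman kernel, obtained from the smaller disks because `f` need
not extend continuously to the boundary. -/
theorem integral_reproducing {f : ℂ → ℂ} (hf : DifferentiableOn ℂ f (ball 0 1)) {z : ℂ}
    (hz : ‖z‖ < 1) (hint : IntegrableOn (fun w => f w / (1 - z * conj w) ^ 2) (ball 0 1)) :
    ∫ w in ball 0 1, f w / (1 - z * conj w) ^ 2 = π * f z := by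
  set s : ℕ → ℝ := fun n => 1 - 1 / ((n : ℝ) + 2) with hs
  have hs0 : ∀ n, 0 < s n := fun n => by
    have : (1 : ℝ) / ((n : ℝ) + 2) < 1 := by
      rw [div_lt_one (by positivity)]
      linarith [(Nat.cast_nonneg n : (0 : ℝ) ≤ n)]
    simp only [hs]
    linarith
  have hs1 : ∀ n, s n < 1 := fun n => by
    have : (0 : ℝ) < 1 / ((n : ℝ) + 2) := by positivity
    simp only [hs]
    linarith
  have hmono : Monotone s := fun m n h => by
    have : (m : ℝ) ≤ n := by exact_mod_cast h
    simp only [hs]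
    gcongr
  have hlim : Tendsto s atTop (𝓝 1) := by
    have h := (tendsto_const_nhds (x := (1 : ℝ))).div_atTop
      (tendsto_atTop_add_const_right atTop (2 : ℝ) tendsto_natCast_atTop_atTop)
    simpa [hs] using h.const_sub 1
  have hU : ⋃ n, ball (0 : ℂ) (s n) = ball 0 1 := by
    refine Subset.antisymm (iUnion_subset fun n => ball_subset_ball (hs1 n).le) fun w hw => ?_
    obtain ⟨n, hn⟩ := (hlim.eventually (lt_mem_nhds (mem_ball.1 hw))).exists
    exact mem_iUnion.2 ⟨n, hn⟩
  have hleft := tendsto_setIntegral_of_monotone (μ := volume)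
    (f := fun w => f w / (1 - z * conj w) ^ 2)
    (fun n => measurableSet_ball) (fun m n h => ball_subset_ball (x := (0 : ℂ)) (hmono h))
    (by rwa [hU])
  rw [hU] at hleft
  have hzmem : z ∈ ball (0 : ℂ) 1 := by simpa using hz
  have hright : Tendsto (fun n => (π : ℂ) * (s n : ℂ) ^ 2 * f ((s n : ℂ) ^ 2 * z)) atTop
      (𝓝 (π * 1 ^ 2 * f z)) := by
    have hc : Tendsto (fun n => (s n : ℂ)) atTop (𝓝 1) := by
      simpa using! (Complex.continuous_ofReal.tendsto 1).comp hlim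
    refine ((tendsto_const_nhds.mul (hc.pow 2))).mul ?_
    have hfc : ContinuousAt f z :=
      (hf.differentiableAt (isOpen_ball.mem_nhds hzmem)).continuousAt
    refine hfc.tendsto.comp ?_
    simpa using (hc.pow 2).mul_const z
  refine (tendsto_nhds_unique hleft ?_).trans (by ring : (π : ℂ) * 1 ^ 2 * f z = π * f z)
  refine hright.congr fun n => ?_
  rw [integral_ball_reproducing hf hz (hs0 n) (hs1 n)]

/-! ### The Bergman space as a reproducing kernel Hilbert space -/

theorem norm_coe_lt_one (z : Disk) : ‖(z : ℂ)‖ < 1 := mem_ball_zero_iff.1 z.2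

instance : IsFiniteMeasure areaMeasure := by
  constructor
  rw [areaMeasure, Measure.smul_apply, smul_eq_mul, Measure.restrict_apply_univ]
  exact ENNReal.mul_lt_top ENNReal.ofReal_lt_top measure_ball_lt_top

theorem ae_areaMeasure_mem_ball : ∀ᵐ w ∂areaMeasure, w ∈ ball (0 : ℂ) 1 :=
  Measure.ae_smul_measure (ae_restrict_mem measurableSet_ball) _

theorem aestronglyMeasurable_of_differentiableOn {g : ℂ → ℂ}
    (hg : DifferentiableOn ℂ g (ball 0 1)) : AEStronglyMeasurable g areaMeasure :=
  (hg.continuousOn.aestronglyMeasurable measurableSet_ball).smul_measure _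

/-- The analytic representative of an element of the Bergman space. -/
def rep (f : BergmanSpace) : ℂ → ℂ := Classical.choose f.2

theorem differentiableOn_rep (f : BergmanSpace) : DifferentiableOn ℂ (rep f) (ball 0 1) :=
  (Classical.choose_spec f.2).1

theorem coe_ae_eq_rep (f : BergmanSpace) : (f : Lp ℂ 2 areaMeasure) =ᵐ[areaMeasure] rep f :=
  (Classical.choose_spec f.2).2

theorem eval_eq_rep (f : BergmanSpace) (z : Disk) : eval f z = rep f z := rfl

theorem eval_add (f g : BergmanSpace) (z : Disk) : eval (f + g) z = eval f z + eval g z :=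
  eval_eq _ ((differentiableOn_rep f).add (differentiableOn_rep g))
    ((Lp.coeFn_add _ _).trans ((coe_ae_eq_rep f).add (coe_ae_eq_rep g))) z

theorem eval_smul (c : ℂ) (f : BergmanSpace) (z : Disk) : eval (c • f) z = c * eval f z :=
  eval_eq _ ((differentiableOn_rep f).const_smul c)
    ((Lp.coeFn_smul _ _).trans ((coe_ae_eq_rep f).const_smul c)) z

theorem eval_sub (f g : BergmanSpace) (z : Disk) : eval (f - g) z = eval f z - eval g z :=
  eval_eq _ ((differentiableOn_rep f).sub (differentiableOn_rep g))
    ((Lp.coeFn_sub _ _).trans ((coe_ae_eq_rep f).sub (coe_ae_eq_rep g))) z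

theorem eval_zero (z : Disk) : eval 0 z = 0 := by simpa using eval_smul 0 0 z

theorem ext_eval {f g : BergmanSpace} (h : ∀ z, eval f z = eval g z) : f = g := by
  refine Subtype.ext (Lp.ext ((coe_ae_eq_rep f).trans (EventuallyEq.trans ?_
    (coe_ae_eq_rep g).symm)))
  filter_upwards [ae_areaMeasure_mem_ball] with w hw
  exact h ⟨w, hw⟩

/-- The element of the Bergman space with a given square integrable analytic representative. -/
def ofAnalytic (g : ℂ → ℂ) (hg : DifferentiableOn ℂ g (ball 0 1)) (hm : MemLp g 2 areaMeasure) :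
    BergmanSpace :=
  ⟨hm.toLp g, g, hg, hm.coeFn_toLp⟩

theorem eval_ofAnalytic {g : ℂ → ℂ} (hg : DifferentiableOn ℂ g (ball 0 1))
    (hm : MemLp g 2 areaMeasure) (z : Disk) : eval (ofAnalytic g hg hm) z = g z :=
  eval_eq _ hg hm.coeFn_toLp z

theorem memLp_rep (f : BergmanSpace) : MemLp (rep f) 2 areaMeasure :=
  (Lp.memLp (f : Lp ℂ 2 areaMeasure)).ae_eq (coe_ae_eq_rep f)

theorem enorm_sq_eq_lintegral (f : BergmanSpace) :
    ‖f‖ₑ ^ 2 = ENNReal.ofReal π⁻¹ * ∫⁻ w in ball 0 1, ‖rep f w‖ₑ ^ 2 := by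
  have h1 : ‖f‖ₑ = eLpNorm (rep f) 2 areaMeasure := by
    rw [← eLpNorm_congr_ae (coe_ae_eq_rep f), ← Lp.enorm_def]
    rfl
  have h2 := eLpNorm_nnreal_pow_eq_lintegral (f := rep f) (μ := areaMeasure) (p := 2) two_ne_zero
  simp only [NNReal.coe_ofNat, ENNReal.rpow_ofNat, ENNReal.coe_ofNat] at h2
  rw [h1, h2, areaMeasure, lintegral_smul_measure, smul_eq_mul]

/-- Point evaluations are bounded on the Bergman space, locally uniformly in the point. -/
theorem norm_eval_mul_le (f : BergmanSpace) (z : Disk) :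
    ‖eval f z‖ * (1 - ‖(z : ℂ)‖) ≤ ‖f‖ := by
  have hz := norm_coe_lt_one z
  set s := 1 - ‖(z : ℂ)‖ with hs
  have hs0 : 0 ≤ s := by linarith
  have hsub : ball (z : ℂ) s ⊆ ball 0 1 := by
    refine ball_subset_ball' ?_
    simp [hs]
  have h1 := (sub_mean_value hs0 ((differentiableOn_rep f).mono hsub)).trans
    (lintegral_mono_set (f := fun w => ‖rep f w‖ₑ ^ 2) hsub)
  have h2 : ENNReal.ofReal (s ^ 2) * ‖eval f z‖ₑ ^ 2 ≤ ‖f‖ₑ ^ 2 := by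
    rw [enorm_sq_eq_lintegral]
    refine le_trans (le_of_eq ?_) (mul_le_mul_right h1 (ENNReal.ofReal π⁻¹))
    rw [← mul_assoc, ← ENNReal.ofReal_mul (by positivity), ← mul_assoc,
      inv_mul_cancel₀ Real.pi_ne_zero, one_mul, eval_eq_rep]
  rw [← ofReal_norm, ← ofReal_norm, ← ENNReal.ofReal_pow (norm_nonneg _),
    ← ENNReal.ofReal_pow (norm_nonneg _), ← ENNReal.ofReal_mul (by positivity),
    ENNReal.ofReal_le_ofReal_iff (by positivity), ← mul_pow] at h2
  rw [mul_comm]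
  exact (sq_le_sq₀ (by positivity) (norm_nonneg _)).1 h2

/-- The Bergman space is complete: convergence in norm implies locally uniform convergence of the
analytic representatives, whose limit is analytic. -/
theorem isClosed_bergmanSpace : IsClosed (BergmanSpace : Set (Lp ℂ 2 areaMeasure)) := by
  refine isClosed_of_closure_subset fun x hx => ?_
  obtain ⟨u, hu, hlim⟩ := mem_closure_iff_seq_limit.1 hx
  set v : ℕ → BergmanSpace := fun n => ⟨u n, hu n⟩ with hv
  have hcauchy : CauchySeq v := by
    have h := hlim.cauchySeq
    rw [Metric.cauchySeq_iff] at h ⊢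
    exact h
  have hle : ∀ m n, ∀ w ∈ ball (0 : ℂ) 1,
      ‖rep (v m) w - rep (v n) w‖ * (1 - ‖w‖) ≤ ‖v m - v n‖ := fun m n w hw => by
    have h := norm_eval_mul_le (v m - v n) ⟨w, hw⟩
    rwa [eval_sub] at h
  -- on `|w| < s` the difference of two representatives is at most the norm divided by `1 - s`
  have hUC : ∀ s < (1 : ℝ), UniformCauchySeqOn (fun n => rep (v n)) atTop (ball 0 s) := by
    intro s hs
    rw [Metric.uniformCauchySeqOn_iff]
    intro ε hε
    obtain ⟨N, hN⟩ := Metric.cauchySeq_iff.1 hcauchy (ε * (1 - s))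
      (mul_pos hε (by linarith))
    refine ⟨N, fun m hm n hn w hw => ?_⟩
    have hws : ‖w‖ < s := by simpa using hw
    have h1 := hle m n w (by simpa using hws.trans hs)
    have h2 := hN m hm n hn
    rw [dist_eq_norm] at h2 ⊢
    by_contra! hcon
    nlinarith
  have hmem : ∀ w ∈ ball (0 : ℂ) 1, ∃ s < (1 : ℝ), w ∈ ball (0 : ℂ) s := fun w hw => by
    obtain ⟨s, h1, h2⟩ := exists_between (mem_ball.1 hw)
    exact ⟨s, h2, h1⟩
  have hpt : ∀ w ∈ ball (0 : ℂ) 1, ∃ y, Tendsto (fun n => rep (v n) w) atTop (𝓝 y) := by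
    intro w hw
    obtain ⟨s, hs, hws⟩ := hmem w hw
    exact cauchySeq_tendsto_of_complete ((hUC s hs).cauchySeq hws)
  choose! G hG using hpt
  have hU : ∀ s < (1 : ℝ), TendstoUniformlyOn (fun n => rep (v n)) G atTop (ball 0 s) :=
    fun s hs => (hUC s hs).tendstoUniformlyOn_of_tendsto
      fun w hw => hG w (ball_subset_ball hs.le hw)
  have hdiff : DifferentiableOn ℂ G (ball 0 1) := by
    intro w hw
    obtain ⟨s, hs, hws⟩ := hmem w hw
    have := (hU s hs).tendstoLocallyUniformlyOn.differentiableOn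
      (.of_forall fun n => (differentiableOn_rep (v n)).mono (ball_subset_ball hs.le)) isOpen_ball
    exact (this.differentiableAt (isOpen_ball.mem_nhds hws)).differentiableWithinAt
  refine ⟨G, hdiff, ?_⟩
  -- a subsequence converges almost everywhere, which identifies the limit in `L²` with `G`
  obtain ⟨ns, hns, hae⟩ := (tendstoInMeasure_of_tendsto_Lp hlim).exists_seq_tendsto_ae
  have hrep : ∀ᵐ w ∂areaMeasure, ∀ n, (u n : ℂ → ℂ) w = rep (v n) w :=
    ae_all_iff.2 fun n => coe_ae_eq_rep (v n)
  filter_upwards [hae, hrep, ae_areaMeasure_mem_ball] with w h1 h2 h3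
  simp only [h2] at h1
  exact tendsto_nhds_unique h1 ((hG w h3).comp hns.tendsto_atTop)

instance : CompleteSpace BergmanSpace := isClosed_bergmanSpace.completeSpace_coe

theorem norm_conj_mul_lt_one (z : Disk) {w : ℂ} (hw : ‖w‖ ≤ 1) : ‖conj (z : ℂ) * w‖ < 1 := by
  rw [norm_mul, RCLike.norm_conj]
  nlinarith [norm_nonneg (z : ℂ), norm_nonneg w, norm_coe_lt_one z]

theorem one_sub_norm_le (z : Disk) {w : ℂ} (hw : ‖w‖ ≤ 1) :
    1 - ‖(z : ℂ)‖ ≤ ‖1 - conj (z : ℂ) * w‖ := by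
  have h1 := norm_sub_norm_le (1 : ℂ) (conj (z : ℂ) * w)
  rw [norm_one, norm_mul, RCLike.norm_conj] at h1
  nlinarith [norm_nonneg (z : ℂ)]

theorem differentiableOn_kernel (z : Disk) : DifferentiableOn ℂ (kernel z) (ball 0 1) := by
  intro w hw
  have hw1 : ‖w‖ ≤ 1 := by simpa using (mem_ball.1 hw).le
  unfold kernel
  refine DifferentiableAt.differentiableWithinAt (DifferentiableAt.div (by fun_prop) (by fun_prop)
    (pow_ne_zero 2 (one_sub_ne_zero_of_norm_lt (norm_conj_mul_lt_one z hw1))))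

theorem norm_kernel_le (z : Disk) {w : ℂ} (hw : ‖w‖ ≤ 1) :
    ‖kernel z w‖ ≤ 1 / (1 - ‖(z : ℂ)‖) ^ 2 := by
  have h := one_sub_norm_le z hw
  have hz := norm_coe_lt_one z
  have h0 : 0 < 1 - ‖(z : ℂ)‖ := by linarith
  rw [kernel, norm_div, norm_one, norm_pow]
  gcongr

theorem memLp_kernel (z : Disk) : MemLp (kernel z) 2 areaMeasure := by
  refine MemLp.of_bound (aestronglyMeasurable_of_differentiableOn (differentiableOn_kernel z))
    (1 / (1 - ‖(z : ℂ)‖) ^ 2) ?_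
  filter_upwards [ae_areaMeasure_mem_ball] with w hw
  exact norm_kernel_le z (by simpa using (mem_ball.1 hw).le)

/-- The reproducing kernel as an element of the Bergman space. -/
def kernelElem (z : Disk) : BergmanSpace :=
  ofAnalytic (kernel z) (differentiableOn_kernel z) (memLp_kernel z)

theorem eval_kernelElem (z w : Disk) : eval (kernelElem z) w = kernel z w :=
  eval_ofAnalytic _ _ w

theorem inner_kernelElem (z : Disk) (f : BergmanSpace) :
    inner ℂ (kernelElem z) f = eval f z := by
  have hae : (fun w => inner ℂ ((kernelElem z : Lp ℂ 2 areaMeasure) w)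
      ((f : Lp ℂ 2 areaMeasure) w)) =ᵐ[areaMeasure]
      fun w => rep f w / (1 - (z : ℂ) * conj w) ^ 2 := by
    filter_upwards [coe_ae_eq_rep f, (memLp_kernel z).coeFn_toLp] with w h1 h2
    have h3 : (kernelElem z : Lp ℂ 2 areaMeasure) w = kernel z w := h2
    rw [h1, h3, RCLike.inner_apply, kernel]
    simp [div_eq_mul_inv]
  have hint := (L2.integrable_inner (𝕜 := ℂ) (kernelElem z : Lp ℂ 2 areaMeasure)
    (f : Lp ℂ 2 areaMeasure)).congr hae
  have hint' : IntegrableOn (fun w => rep f w / (1 - (z : ℂ) * conj w) ^ 2) (ball 0 1) := by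
    rw [areaMeasure, integrable_smul_measure (by simp [Real.pi_pos]) ENNReal.ofReal_ne_top] at hint
    exact hint
  rw [Submodule.coe_inner, L2.inner_def, integral_congr_ae hae, areaMeasure,
    integral_smul_measure, integral_reproducing (differentiableOn_rep f) (norm_coe_lt_one z) hint',
    ENNReal.toReal_ofReal (by positivity), eval_eq_rep, Complex.real_smul]
  push_cast
  rw [← mul_assoc, inv_mul_cancel₀ (by exact_mod_cast Real.pi_ne_zero), one_mul]

theorem kernel_self (z : Disk) : kernel z z = ((1 / (1 - ‖(z : ℂ)‖ ^ 2) ^ 2 : ℝ) : ℂ) := by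
  rw [kernel, mul_comm, Complex.mul_conj, Complex.normSq_eq_norm_sq]
  push_cast
  rfl

theorem norm_kernelElem_sq (z : Disk) :
    ‖kernelElem z‖ ^ 2 = 1 / (1 - ‖(z : ℂ)‖ ^ 2) ^ 2 := by
  have h := inner_kernelElem z (kernelElem z)
  rw [eval_kernelElem, kernel_self] at h
  have h2 := (inner_self_eq_norm_sq_to_K (𝕜 := ℂ) (kernelElem z)).symm.trans h
  exact Complex.ofReal_injective (by simpa using h2)

theorem integral_norm_kernel_sq (z : Disk) :
    ∫ u, ‖kernel z u‖ ^ 2 ∂areaMeasure = 1 / (1 - ‖(z : ℂ)‖ ^ 2) ^ 2 := by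
  rw [← norm_kernelElem_sq]
  have h := inner_self_eq_norm_sq_to_K (𝕜 := ℂ) (kernelElem z)
  rw [Submodule.coe_inner, L2.inner_def] at h
  have hae : (fun w => inner ℂ ((kernelElem z : Lp ℂ 2 areaMeasure) w)
      ((kernelElem z : Lp ℂ 2 areaMeasure) w)) =ᵐ[areaMeasure]
      fun w => ((‖kernel z w‖ ^ 2 : ℝ) : ℂ) := by
    filter_upwards [(memLp_kernel z).coeFn_toLp] with w h2
    have h3 : (kernelElem z : Lp ℂ 2 areaMeasure) w = kernel z w := h2
    rw [h3, inner_self_eq_norm_sq_to_K]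
    push_cast
    rfl
  rw [integral_congr_ae hae, integral_complex_ofReal] at h
  exact Complex.ofReal_injective (by simpa using h)

theorem norm_normalizedKernel_sq (z w : Disk) :
    ‖normalizedKernel z w‖ ^ 2 =
      (1 - ‖(z : ℂ)‖ ^ 2) ^ 2 / ‖1 - conj (z : ℂ) * w‖ ^ 4 := by
  have hz : 0 < 1 - ‖(z : ℂ)‖ ^ 2 := by nlinarith [norm_coe_lt_one z, norm_nonneg (z : ℂ)]
  rw [normalizedKernel, integral_norm_kernel_sq, norm_div, Complex.norm_real, div_pow,
    Real.norm_of_nonneg (Real.sqrt_nonneg _), Real.sq_sqrt (by positivity), kernel, norm_div,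
    norm_one, norm_pow]
  field_simp

/-! ### Sums over separated points -/

theorem one_sub_norm_le_norm_one_sub_mul {a b : ℂ} (hb : ‖b‖ ≤ 1) :
    1 - ‖a‖ ≤ ‖1 - a * b‖ := by
  have h1 := norm_sub_norm_le (1 : ℂ) (a * b)
  rw [norm_one, norm_mul] at h1
  nlinarith [norm_nonneg a]

/-- Uniform separation of a family of points of the disk, at pseudo-hyperbolic distance at least
`1 / 2`, in a form without division. -/
def Separated {ι : Type*} (c : ι → ℂ) : Prop :=
  (∀ i, ‖c i‖ < 1) ∧ ∀ i j, i ≠ j → ‖1 - conj (c i) * c j‖ ≤ 2 * ‖c j - c i‖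

theorem disjoint_ball_of_separated {a b : ℂ} (ha : ‖a‖ < 1) (hb : ‖b‖ < 1)
    (h : ‖1 - conj a * b‖ ≤ 2 * ‖b - a‖) :
    Disjoint (ball a ((1 - ‖a‖) / 4)) (ball b ((1 - ‖b‖) / 4)) := by
  rw [Set.disjoint_left]
  intro w h1 h2
  rw [mem_ball, dist_eq_norm] at h1 h2
  have h3 : ‖b - a‖ ≤ ‖w - a‖ + ‖w - b‖ := by
    rw [show b - a = (w - a) - (w - b) by ring]
    exact norm_sub_le _ _
  have h4 := one_sub_norm_le_norm_one_sub_mul (a := conj a) hb.le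
  have h5 := one_sub_norm_le_norm_one_sub_mul (a := b) (b := conj a)
    (by rw [RCLike.norm_conj]; exact ha.le)
  rw [mul_comm b] at h5
  rw [RCLike.norm_conj] at h4
  linarith

/-- For separated points the disks of radius `(1 - |c|) / 4` are disjoint, so that local integral
bounds add up. -/
theorem sum_le_lintegral_of_separated {ι : Type*} {c : ι → ℂ} (hc : Separated c) (F : Finset ι)
    {g : ℂ → ℝ≥0∞} {u : ι → ℝ≥0∞}
    (hu : ∀ i ∈ F, u i ≤ ∫⁻ w in ball (c i) ((1 - ‖c i‖) / 4), g w) :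
    ∑ i ∈ F, u i ≤ ∫⁻ w in ball 0 1, g w := by
  refine (Finset.sum_le_sum hu).trans ?_
  rw [← lintegral_biUnion_finset (fun i _ j _ hij => disjoint_ball_of_separated (hc.1 i) (hc.1 j)
    (hc.2 i j hij)) fun i _ => measurableSet_ball]
  refine lintegral_mono_set (iUnion₂_subset fun i _ => ball_subset_ball' ?_)
  rw [dist_zero_right]
  linarith [hc.1 i]

/-- The restriction of a Bergman function to a separated sequence is square summable with the
weights `(1 - |b|²)²`. -/
theorem sum_weight_mul_eval_sq_le {ι : Type*} {b : ι → Disk} (hb : Separated fun i => (b i : ℂ))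
    (f : BergmanSpace) (F : Finset ι) :
    ∑ i ∈ F, ((1 - ‖(b i : ℂ)‖ ^ 2) * ‖eval f (b i)‖) ^ 2 ≤ 64 * ‖f‖ ^ 2 := by
  have h1 := sum_le_lintegral_of_separated hb F (g := fun w => ‖rep f w‖ₑ ^ 2)
    (u := fun i => ENNReal.ofReal (π * ((1 - ‖(b i : ℂ)‖) / 4) ^ 2) * ‖rep f (b i)‖ₑ ^ 2)
    fun i _ => by
      have hi := norm_coe_lt_one (b i)
      refine sub_mean_value (by linarith) ((differentiableOn_rep f).mono ?_)
      refine ball_subset_ball' ?_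
      rw [dist_zero_right]
      linarith
  have h2 := mul_le_mul_right h1 (ENNReal.ofReal π⁻¹)
  rw [← enorm_sq_eq_lintegral, Finset.mul_sum] at h2
  have h3 : ∀ i, ENNReal.ofReal π⁻¹ * (ENNReal.ofReal (π * ((1 - ‖(b i : ℂ)‖) / 4) ^ 2) *
      ‖rep f (b i)‖ₑ ^ 2) = ENNReal.ofReal (((1 - ‖(b i : ℂ)‖) / 4 * ‖eval f (b i)‖) ^ 2) := by
    intro i
    rw [← mul_assoc, ← ENNReal.ofReal_mul (by positivity), ← mul_assoc,
      inv_mul_cancel₀ Real.pi_ne_zero, one_mul, ← ofReal_norm,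
      ← ENNReal.ofReal_pow (norm_nonneg _), ← ENNReal.ofReal_mul (by positivity), ← mul_pow,
      eval_eq_rep]
  simp only [h3] at h2
  rw [← ofReal_norm, ← ENNReal.ofReal_pow (norm_nonneg _),
    ← ENNReal.ofReal_sum_of_nonneg (fun i _ => by positivity),
    ENNReal.ofReal_le_ofReal_iff (by positivity)] at h2
  refine le_trans ?_ (mul_le_mul_of_nonneg_left h2 (by norm_num : (0 : ℝ) ≤ 64))
  rw [Finset.mul_sum]
  refine Finset.sum_le_sum fun i _ => ?_
  have hi := norm_coe_lt_one (b i)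
  have hn := norm_nonneg (b i : ℂ)
  -- `64 = 4 * 4²`, from `(1 + |b|)² ≤ 4` and the radius `(1 - |b|) / 4`
  have h4 : (1 - ‖(b i : ℂ)‖ ^ 2) ^ 2 ≤ 64 * ((1 - ‖(b i : ℂ)‖) / 4) ^ 2 := by
    have : (1 - ‖(b i : ℂ)‖ ^ 2) ^ 2 = (1 - ‖(b i : ℂ)‖) ^ 2 * (1 + ‖(b i : ℂ)‖) ^ 2 := by ring
    rw [this]
    nlinarith [mul_le_mul_of_nonneg_left
      (show (1 + ‖(b i : ℂ)‖) ^ 2 ≤ 4 by nlinarith) (sq_nonneg (1 - ‖(b i : ℂ)‖))]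
  rw [mul_pow, mul_pow, ← mul_assoc]
  gcongr

theorem abs_div_pi_le_norm_one_sub {r θ : ℝ} (hr0 : 0 ≤ r) (hr1 : r ≤ 1) (hθ : |θ| ≤ π) :
    |θ| / π ≤ ‖1 - (r : ℂ) * Complex.exp (Complex.I * θ)‖ := by
  set e := Complex.exp (Complex.I * θ) with he
  have hen : ‖e‖ = 1 := by
    rw [he, mul_comm]
    exact Complex.norm_exp_ofReal_mul_I θ
  have h1 : ‖e - 1‖ = 2 * |Real.sin (θ / 2)| := by
    rw [he, Complex.norm_exp_I_mul_ofReal_sub_one, norm_mul]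
    simp
  have h2 : ‖e - 1‖ ≤ 2 * ‖1 - (r : ℂ) * e‖ := by
    have h3 : ‖e - 1‖ ≤ ‖((1 - r : ℝ) : ℂ) * e‖ + ‖1 - (r : ℂ) * e‖ := by
      rw [show e - 1 = ((1 - r : ℝ) : ℂ) * e - (1 - (r : ℂ) * e) by push_cast; ring]
      exact norm_sub_le _ _
    rw [norm_mul, hen, Complex.norm_real, Real.norm_of_nonneg (by linarith), mul_one] at h3
    have h4 := one_sub_norm_le_norm_one_sub_mul (a := (r : ℂ)) (b := e) hen.le
    rw [Complex.norm_real, Real.norm_of_nonneg hr0] at h4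
    linarith
  have h5 := Real.mul_abs_le_abs_sin (x := θ / 2) (by rw [abs_div, abs_two]; linarith)
  rw [abs_div, abs_two] at h5
  have h6 : |θ| / π = 2 / π * (|θ| / 2) := by ring
  rw [h6]
  linarith

/-- The product bound `(1 - |w|)^(-7/8) (|arg w| / π)^(-7/8)` for the weighted kernel, which is
integrable in polar coordinates uniformly in the parameter `x`. -/
theorem weight_kernel_le {x r θ : ℝ} (hx0 : 0 ≤ x) (hx1 : x ≤ 1) (hr0 : 0 < r) (hr1 : r < 1)
    (hθ0 : θ ≠ 0) (hθ : |θ| ≤ π) :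
    (1 - r) ^ (-(3 / 4) : ℝ) / ‖1 - (x : ℂ) * circleMap 0 r θ‖ ≤
      (1 - r) ^ (-(7 / 8) : ℝ) * (|θ| / π) ^ (-(7 / 8) : ℝ) := by
  have h1 : (x : ℂ) * circleMap 0 r θ = ((x * r : ℝ) : ℂ) * Complex.exp (Complex.I * θ) := by
    rw [circleMap, mul_comm Complex.I]
    push_cast
    ring
  have hxr : x * r ≤ r := by nlinarith
  have hxr0 : 0 ≤ x * r := by positivity
  have hq := abs_div_pi_le_norm_one_sub hxr0 (by linarith) hθ
  have hp : 1 - r ≤ ‖1 - (x : ℂ) * circleMap 0 r θ‖ := by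
    have hn : ‖Complex.exp (Complex.I * θ)‖ = 1 := by
      rw [mul_comm]
      exact Complex.norm_exp_ofReal_mul_I θ
    have := one_sub_norm_le_norm_one_sub_mul (a := ((x * r : ℝ) : ℂ))
      (b := Complex.exp (Complex.I * θ)) hn.le
    rw [Complex.norm_real, Real.norm_of_nonneg hxr0] at this
    rw [h1]
    linarith
  rw [← h1] at hq
  set A := ‖1 - (x : ℂ) * circleMap 0 r θ‖ with hA
  have hp0 : 0 < 1 - r := by linarith
  have hA0 : 0 < A := hp0.trans_le hp
  have hq0 : 0 < |θ| / π := by positivity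
  -- `A` dominates both `1 - r` and `|θ| / π`; splitting `A⁻¹` balances the two singularities
  have h2 : A⁻¹ = A ^ (-(1 / 8) : ℝ) * A ^ (-(7 / 8) : ℝ) := by
    rw [← Real.rpow_add hA0, ← Real.rpow_neg_one]
    norm_num
  have h3 : (1 - r) ^ (-(7 / 8) : ℝ) = (1 - r) ^ (-(3 / 4) : ℝ) * (1 - r) ^ (-(1 / 8) : ℝ) := by
    rw [← Real.rpow_add hp0]
    norm_num
  rw [div_eq_mul_inv, h2, h3, mul_assoc]
  gcongr ?_ * (?_ * ?_)
  · exact Real.rpow_le_rpow_of_nonpos hp0 hp (by norm_num)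
  · exact Real.rpow_le_rpow_of_nonpos hq0 hq (by norm_num)

theorem lintegral_radial_weight_lt_top :
    ∫⁻ r in Ioo (0 : ℝ) 1, ENNReal.ofReal ((1 - r) ^ (-(7 / 8) : ℝ)) < ∞ := by
  have h1 : IntervalIntegrable (fun x : ℝ => x ^ (-(7 / 8) : ℝ)) volume 0 1 :=
    intervalIntegral.intervalIntegrable_rpow' (by norm_num)
  have h2 := (h1.comp_sub_left 1).symm
  simp only [sub_zero, sub_self] at h2
  rw [intervalIntegrable_iff_integrableOn_Ioo_of_le zero_le_one] at h2
  exact Integrable.lintegral_lt_top h2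

theorem lintegral_angular_weight_lt_top :
    ∫⁻ θ in Ioo (-π) π, ENNReal.ofReal ((|θ| / π) ^ (-(7 / 8) : ℝ)) < ∞ := by
  have h1 : IntervalIntegrable (fun x : ℝ => x ^ (-(7 / 8) : ℝ)) volume 0 π :=
    intervalIntegral.intervalIntegrable_rpow' (by norm_num)
  have h1' : IntervalIntegrable (fun x : ℝ => |x| ^ (-(7 / 8) : ℝ)) volume 0 π :=
    h1.congr fun x hx => by
      rw [uIoc_of_le Real.pi_pos.le] at hx
      simp only [abs_of_pos hx.1]
  have h2 : IntervalIntegrable (fun x : ℝ => |x| ^ (-(7 / 8) : ℝ)) volume (-π) 0 := by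
    have := (h1'.comp_sub_left 0).symm
    simpa using this
  have h3 := (h2.trans h1').mul_const (π ^ (-(7 / 8) : ℝ))⁻¹
  rw [intervalIntegrable_iff_integrableOn_Ioo_of_le (by linarith [Real.pi_pos])] at h3
  refine lt_of_le_of_lt (le_of_eq ?_) (Integrable.lintegral_lt_top h3)
  congr 1 with θ
  rw [Real.div_rpow (abs_nonneg _) Real.pi_pos.le, div_eq_mul_inv]

theorem exists_lintegral_weight_kernel_le : ∃ C : ℝ≥0∞, C < ∞ ∧ ∀ x : ℝ, 0 ≤ x → x ≤ 1 →
    ∫⁻ w in ball (0 : ℂ) 1,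
      ENNReal.ofReal ((1 - ‖w‖) ^ (-(3 / 4) : ℝ) / ‖1 - (x : ℂ) * w‖) ≤ C := by
  refine ⟨(∫⁻ r in Ioo (0 : ℝ) 1, ENNReal.ofReal ((1 - r) ^ (-(7 / 8) : ℝ))) *
    ∫⁻ θ in Ioo (-π) π, ENNReal.ofReal ((|θ| / π) ^ (-(7 / 8) : ℝ)),
    ENNReal.mul_lt_top lintegral_radial_weight_lt_top lintegral_angular_weight_lt_top, ?_⟩
  intro x hx0 hx1
  rw [lintegral_ball_eq_polar (by fun_prop), ← lintegral_mul_const'' _ (by fun_prop)]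
  refine setLIntegral_mono' measurableSet_Ioo fun r hr => ?_
  calc _ ≤ 1 * ∫⁻ θ in Ioo (-π) π, ENNReal.ofReal ((1 - ‖circleMap 0 r θ‖) ^ (-(3 / 4) : ℝ) /
          ‖1 - (x : ℂ) * circleMap 0 r θ‖) := by
        gcongr
        exact ENNReal.ofReal_le_one.2 hr.2.le
    _ ≤ ∫⁻ θ in Ioo (-π) π, ENNReal.ofReal ((1 - r) ^ (-(7 / 8) : ℝ)) *
          ENNReal.ofReal ((|θ| / π) ^ (-(7 / 8) : ℝ)) := by
        rw [one_mul]
        refine lintegral_mono_ae ?_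
        -- at `θ = 0` the real power is `0` by convention, and the bound would fail
        have hne : ∀ᵐ θ : ℝ ∂(volume.restrict (Ioo (-π) π)), θ ≠ 0 :=
          ae_restrict_of_ae (Measure.ae_ne volume 0)
        filter_upwards [hne, ae_restrict_mem measurableSet_Ioo] with θ h0 hθ
        have hp : 0 ≤ (1 - r) ^ (-(7 / 8) : ℝ) := Real.rpow_nonneg (by linarith [hr.2]) _
        rw [← ENNReal.ofReal_mul hp, norm_circleMap_zero, abs_of_pos hr.1]
        exact ENNReal.ofReal_le_ofReal
          (weight_kernel_le hx0 hx1 hr.1 hr.2 h0 (abs_le.2 ⟨hθ.1.le, hθ.2.le⟩))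
    _ = _ := lintegral_const_mul' _ _ ENNReal.ofReal_ne_top

/-- A bound, uniform in the separated family and in `x ∈ [0, 1]`, for the weighted sum of the kernel
`1 / |1 - x c|`: on the disk around `c` the weight `(1 - |w|)^(-3/4) / |1 - x w|` is comparable to
its value at `c`, and integrating over the area `≍ (1 - |c|)²` raises the exponent to `5 / 4`. -/
theorem exists_sum_weight_kernel_le : ∃ C : ℝ, 0 < C ∧ ∀ (ι : Type) (c : ι → ℂ), Separated c →
    ∀ (F : Finset ι) (x : ℝ), 0 ≤ x → x ≤ 1 →
      ∑ i ∈ F, (1 - ‖c i‖) ^ (5 / 4 : ℝ) / ‖1 - (x : ℂ) * c i‖ ≤ C := by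
  obtain ⟨C, hC, h⟩ := exists_lintegral_weight_kernel_le
  refine ⟨64 * (C.toReal + 1), by positivity, fun ι c hc F x hx0 hx1 => ?_⟩
  have hpos : ∀ i, 0 ≤ (1 - ‖c i‖) ^ (5 / 4 : ℝ) / ‖1 - (x : ℂ) * c i‖ := fun i =>
    div_nonneg (Real.rpow_nonneg (by linarith [hc.1 i]) _) (norm_nonneg _)
  have h1 := sum_le_lintegral_of_separated hc F
    (g := fun w => ENNReal.ofReal ((1 - ‖w‖) ^ (-(3 / 4) : ℝ) / ‖1 - (x : ℂ) * w‖))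
    (u := fun i => ENNReal.ofReal (1 / 64 * ((1 - ‖c i‖) ^ (5 / 4 : ℝ) / ‖1 - (x : ℂ) * c i‖)))
    fun i _ => by
      have hi := hc.1 i
      set t := 1 - ‖c i‖ with ht
      have ht0 : 0 < t := by linarith
      have hD : t ≤ ‖1 - (x : ℂ) * c i‖ := by
        rw [mul_comm]
        refine one_sub_norm_le_norm_one_sub_mul ?_
        rwa [Complex.norm_real, Real.norm_of_nonneg hx0]
      set D := ‖1 - (x : ℂ) * c i‖ with hDdef
      have hconst : ∀ w ∈ ball (c i) (t / 4),
          ENNReal.ofReal (1 / 4 * (t ^ (-(3 / 4) : ℝ) / D)) ≤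
          ENNReal.ofReal ((1 - ‖w‖) ^ (-(3 / 4) : ℝ) / ‖1 - (x : ℂ) * w‖) := by
        intro w hw
        rw [mem_ball, dist_eq_norm] at hw
        refine ENNReal.ofReal_le_ofReal ?_
        have hw1 : ‖w‖ ≤ ‖c i‖ + ‖w - c i‖ := by
          simpa using norm_add_le (c i) (w - c i)
        have hw2 : ‖c i‖ ≤ ‖w‖ + ‖w - c i‖ := by
          simpa using norm_sub_le w (w - c i)
        have hwD : ‖1 - (x : ℂ) * w‖ ≤ 2 * D := by
          have h3 : ‖1 - (x : ℂ) * w‖ ≤ D + ‖(x : ℂ) * (w - c i)‖ := by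
            rw [show 1 - (x : ℂ) * w = (1 - (x : ℂ) * c i) - (x : ℂ) * (w - c i) by ring]
            exact norm_sub_le _ _
          rw [norm_mul, Complex.norm_real, Real.norm_of_nonneg hx0] at h3
          nlinarith [norm_nonneg (w - c i)]
        have hw0 : 0 < 1 - ‖w‖ := by linarith
        have hwpos : 0 < ‖1 - (x : ℂ) * w‖ := by
          refine hw0.trans_le ?_
          rw [mul_comm]
          refine one_sub_norm_le_norm_one_sub_mul ?_
          rwa [Complex.norm_real, Real.norm_of_nonneg hx0]
        have hr1 : (2 * t) ^ (-(3 / 4) : ℝ) ≤ (1 - ‖w‖) ^ (-(3 / 4) : ℝ) :=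
          Real.rpow_le_rpow_of_nonpos hw0 (by linarith) (by norm_num)
        have hr2 : 1 / 2 * t ^ (-(3 / 4) : ℝ) ≤ (2 * t) ^ (-(3 / 4) : ℝ) := by
          rw [Real.mul_rpow (by norm_num) ht0.le]
          gcongr
          rw [one_div, ← Real.rpow_neg_one]
          exact Real.rpow_le_rpow_of_exponent_le (by norm_num) (by norm_num)
        calc 1 / 4 * (t ^ (-(3 / 4) : ℝ) / D) = 1 / 2 * t ^ (-(3 / 4) : ℝ) / (2 * D) := by
              field_simp
              norm_num
          _ ≤ _ := by gcongr; exact hr2.trans hr1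
      refine le_trans ?_ (setLIntegral_mono' measurableSet_ball hconst)
      rw [setLIntegral_const, Complex.volume_ball, ← ENNReal.ofReal_pow (by positivity),
        ← ENNReal.ofReal_coe_nnreal, ← ENNReal.ofReal_mul (by positivity),
        ← ENNReal.ofReal_mul (by positivity)]
      refine ENNReal.ofReal_le_ofReal ?_
      have he : t ^ (5 / 4 : ℝ) = t ^ (-(3 / 4) : ℝ) * t ^ 2 := by
        rw [← Real.rpow_natCast t 2, ← Real.rpow_add ht0]
        norm_num
      rw [he]
      have hT : 0 ≤ t ^ (-(3 / 4) : ℝ) / D * t ^ 2 := by positivity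
      have hpi : (1 : ℝ) ≤ (NNReal.pi : ℝ) := by
        rw [NNReal.coe_real_pi]
        linarith [Real.pi_gt_three]
      calc _ = 1 / 64 * (t ^ (-(3 / 4) : ℝ) / D * t ^ 2) * 1 := by ring
        _ ≤ 1 / 64 * (t ^ (-(3 / 4) : ℝ) / D * t ^ 2) * NNReal.pi := by gcongr
        _ = _ := by ring
  have h2 := h1.trans (h x hx0 hx1)
  rw [← ENNReal.ofReal_sum_of_nonneg (fun i _ => mul_nonneg (by norm_num) (hpos i)),
    ENNReal.ofReal_le_iff_le_toReal hC.ne, ← Finset.mul_sum] at h2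
  linarith

/-! ### Disk automorphisms and the Gram matrix of the normalized kernels -/

theorem norm_sq_one_sub_conj_mul_sub (z w : ℂ) :
    ‖1 - conj w * z‖ ^ 2 - ‖w - z‖ ^ 2 = (1 - ‖z‖ ^ 2) * (1 - ‖w‖ ^ 2) := by
  simp only [← Complex.normSq_eq_norm_sq, Complex.normSq_apply]
  simp
  ring

theorem one_sub_norm_sq_pos (z : Disk) : 0 < 1 - ‖(z : ℂ)‖ ^ 2 := by
  nlinarith [norm_coe_lt_one z, norm_nonneg (z : ℂ)]

theorem norm_one_sub_conj_mul_pos (z w : Disk) : 0 < ‖1 - conj (w : ℂ) * z‖ :=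
  norm_pos_iff.2 (one_sub_ne_zero_of_norm_lt (norm_conj_mul_lt_one w (norm_coe_lt_one z).le))

theorem one_sub_pseudoDist_sq (z w : Disk) :
    1 - pseudoDist z w ^ 2 =
      (1 - ‖(z : ℂ)‖ ^ 2) * (1 - ‖(w : ℂ)‖ ^ 2) / ‖1 - conj (w : ℂ) * z‖ ^ 2 := by
  have h := norm_one_sub_conj_mul_pos z w
  rw [← norm_sq_one_sub_conj_mul_sub, pseudoDist, norm_div, sub_div,
    div_self (pow_pos h 2).ne', div_pow]

theorem pseudoDist_nonneg (z w : Disk) : 0 ≤ pseudoDist z w := norm_nonneg _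

theorem pseudoDist_lt_one (z w : Disk) : pseudoDist z w < 1 := by
  have h1 := one_sub_pseudoDist_sq z w
  have h2 : 0 < (1 - ‖(z : ℂ)‖ ^ 2) * (1 - ‖(w : ℂ)‖ ^ 2) / ‖1 - conj (w : ℂ) * z‖ ^ 2 :=
    div_pos (mul_pos (one_sub_norm_sq_pos z) (one_sub_norm_sq_pos w))
      (pow_pos (norm_one_sub_conj_mul_pos z w) 2)
  nlinarith [pseudoDist_nonneg z w]

theorem norm_one_sub_conj_mul_comm (z w : ℂ) : ‖1 - conj w * z‖ = ‖1 - conj z * w‖ := by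
  rw [← RCLike.norm_conj (1 - conj w * z)]
  simp [mul_comm]

theorem pseudoDist_comm (z w : Disk) : pseudoDist z w = pseudoDist w z := by
  rw [pseudoDist, pseudoDist, norm_div, norm_div, norm_sub_rev, norm_one_sub_conj_mul_comm]

theorem separated_of_pseudoDist {ι : Type*} {b : ι → Disk}
    (h : ∀ i j, i ≠ j → 1 / 2 ≤ pseudoDist (b i) (b j)) : Separated fun i => (b i : ℂ) := by
  refine ⟨fun i => norm_coe_lt_one (b i), fun i j hij => ?_⟩
  have h1 := h i j hij
  have h2 := norm_one_sub_conj_mul_pos (b i) (b j)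
  rw [pseudoDist, norm_div, le_div_iff₀ h2] at h1
  rw [norm_one_sub_conj_mul_comm]
  linarith

/-- The disk automorphism `w ↦ (w - z) / (1 - z̄ w)`. -/
def mobius (z w : ℂ) : ℂ := (w - z) / (1 - conj z * w)

theorem norm_mobius (z w : Disk) : ‖mobius z w‖ = pseudoDist z w := by
  rw [mobius, pseudoDist, norm_div, norm_div, norm_one_sub_conj_mul_comm]

theorem norm_one_add_conj_mul_mobius (z w : Disk) :
    ‖1 + conj (z : ℂ) * mobius z w‖ = (1 - ‖(z : ℂ)‖ ^ 2) / ‖1 - conj (z : ℂ) * w‖ := by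
  have h := norm_pos_iff.1 (norm_one_sub_conj_mul_pos w z)
  have h1 : 1 + conj (z : ℂ) * mobius z w =
      ((1 - ‖(z : ℂ)‖ ^ 2 : ℝ) : ℂ) / (1 - conj (z : ℂ) * w) := by
    have h2 : ((‖(z : ℂ)‖ ^ 2 : ℝ) : ℂ) = z * conj (z : ℂ) := by
      rw [Complex.mul_conj, Complex.normSq_eq_norm_sq]
    rw [Complex.ofReal_sub, h2, mobius, eq_div_iff h, add_mul, mul_assoc, div_mul_cancel₀ _ h]
    push_cast
    ring
  rw [h1, norm_div, Complex.norm_real, Real.norm_of_nonneg (one_sub_norm_sq_pos z).le]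

/-- Disk automorphisms preserve the separation of points. -/
theorem mobius_separation (z p q : Disk) (h : ‖1 - conj (q : ℂ) * p‖ ≤ 2 * ‖(p : ℂ) - q‖) :
    ‖1 - conj (mobius z q) * mobius z p‖ ≤ 2 * ‖mobius z p - mobius z q‖ := by
  have hp := norm_pos_iff.1 (norm_one_sub_conj_mul_pos p z)
  have hq := norm_pos_iff.1 (norm_one_sub_conj_mul_pos q z)
  have hq' : 1 - (z : ℂ) * conj (q : ℂ) ≠ 0 := by
    intro h0
    apply hq
    have := congrArg conj h0
    simpa using this
  have h1 : mobius z p - mobius z q = (1 - z * conj (z : ℂ)) * (p - q) /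
      ((1 - conj (z : ℂ) * p) * (1 - conj (z : ℂ) * q)) := by
    rw [mobius, mobius, div_sub_div _ _ hp hq]
    ring
  have h2 : 1 - conj (mobius z q) * mobius z p = (1 - z * conj (z : ℂ)) * (1 - conj (q : ℂ) * p) /
      ((1 - conj (z : ℂ) * p) * (1 - z * conj (q : ℂ))) := by
    rw [mobius, mobius]
    simp only [map_div₀, map_sub, map_mul, map_one, Complex.conj_conj]
    rw [div_mul_div_comm, mul_comm (1 - conj (z : ℂ) * (p : ℂ)),
      eq_div_iff (mul_ne_zero hq' hp), sub_mul, div_mul_cancel₀ _ (mul_ne_zero hq' hp)]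
    ring
  have h3 : ‖1 - (z : ℂ) * conj (q : ℂ)‖ = ‖1 - conj (z : ℂ) * q‖ := by
    rw [← norm_one_sub_conj_mul_comm, mul_comm]
  rw [h1, h2, norm_div, norm_div, norm_mul, norm_mul, norm_mul, norm_mul, h3, ← mul_div_assoc]
  gcongr ?_ / _
  nlinarith [norm_nonneg (1 - (z : ℂ) * conj (z : ℂ))]

theorem exists_norm_one_mul_eq (z : ℂ) : ∃ u : ℂ, ‖u‖ = 1 ∧ (‖z‖ : ℂ) * u = -conj z := by
  by_cases hz : z = 0
  · exact ⟨1, by simp, by simp [hz]⟩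
  · have h : (‖z‖ : ℂ) ≠ 0 := by simpa using hz
    refine ⟨-conj z / ‖z‖, ?_, by field_simp⟩
    rw [norm_div, norm_neg, RCLike.norm_conj, Complex.norm_real, norm_norm, div_self]
    simpa using hz

/-- The Schur test with weights `√(1 - |b|²)` for the Gram matrix of the normalized kernels: after
the disk automorphism that moves `b j` to the origin the sum becomes one over a separated family,
and the factor `(1 - t²)^(1/4)` comes from the mutual distances being at least `t`. -/
theorem exists_gram_schur_bound : ∃ C : ℝ, 0 < C ∧ ∀ (b : ℕ → Disk) (t : ℝ), 1 / 2 ≤ t → t < 1 →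
    (∀ i j, i ≠ j → t ≤ pseudoDist (b i) (b j)) → ∀ (F : Finset ℕ) (j : ℕ),
      ∑ k ∈ F.erase j, (1 - ‖(b j : ℂ)‖ ^ 2) * (1 - ‖(b k : ℂ)‖ ^ 2) /
        ‖1 - conj (b j : ℂ) * b k‖ ^ 2 * √(1 - ‖(b k : ℂ)‖ ^ 2) ≤
      C * (1 - t ^ 2) ^ (1 / 4 : ℝ) * √(1 - ‖(b j : ℂ)‖ ^ 2) := by
  obtain ⟨C, hC, h⟩ := exists_sum_weight_kernel_le
  refine ⟨4 * C, by positivity, fun b t ht ht1 hsep F j => ?_⟩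
  have hb := separated_of_pseudoDist fun i j hij => ht.trans (hsep i j hij)
  obtain ⟨u, hu, hzu⟩ := exists_norm_one_mul_eq (b j)
  have huu : conj u * u = 1 := by
    rw [mul_comm, Complex.mul_conj, Complex.normSq_eq_norm_sq, hu]
    simp
  -- the rotation by `u` turns `-z̄` into the nonnegative number `|z|`, for `z = b j`
  set c : ℕ → ℂ := fun k => u * mobius (b j) (b k) with hcdef
  have hcn : ∀ k, ‖c k‖ = pseudoDist (b j) (b k) := fun k => by
    simp [hcdef, hu, norm_mobius]
  have hc : Separated c := by
    refine ⟨fun k => by rw [hcn]; exact pseudoDist_lt_one _ _, fun i k hik => ?_⟩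
    have h1 := mobius_separation (b j) (b k) (b i) (hb.2 i k hik)
    have h2 : conj (c i) * c k = conj (mobius (b j) (b i)) * mobius (b j) (b k) := by
      simp only [hcdef, map_mul]
      linear_combination conj (mobius (b j) (b i)) * mobius (b j) (b k) * huu
    have h3 : ‖c k - c i‖ = ‖mobius (b j) (b k) - mobius (b j) (b i)‖ := by
      simp only [hcdef]
      rw [← mul_sub, norm_mul, hu, one_mul]
    rw [h2, h3]
    exact h1
  have hsum := h ℕ c hc (F.erase j) ‖(b j : ℂ)‖ (norm_nonneg _) (norm_coe_lt_one _).le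
  have hterm : ∀ k ∈ F.erase j, (1 - ‖(b j : ℂ)‖ ^ 2) * (1 - ‖(b k : ℂ)‖ ^ 2) /
        ‖1 - conj (b j : ℂ) * b k‖ ^ 2 * √(1 - ‖(b k : ℂ)‖ ^ 2) ≤
      4 * (1 - t ^ 2) ^ (1 / 4 : ℝ) * √(1 - ‖(b j : ℂ)‖ ^ 2) *
        ((1 - ‖c k‖) ^ (5 / 4 : ℝ) / ‖1 - (‖(b j : ℂ)‖ : ℂ) * c k‖) := by
    intro k hk
    have hkj : j ≠ k := (Finset.ne_of_mem_erase hk).symm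
    have haj := one_sub_norm_sq_pos (b j)
    have hak := one_sub_norm_sq_pos (b k)
    have hD := norm_one_sub_conj_mul_pos (b k) (b j)
    have hden : ‖1 - (‖(b j : ℂ)‖ : ℂ) * c k‖ =
        (1 - ‖(b j : ℂ)‖ ^ 2) / ‖1 - conj (b j : ℂ) * b k‖ := by
      rw [← norm_one_add_conj_mul_mobius]
      congr 1
      simp only [hcdef]
      linear_combination -mobius (b j) (b k) * hzu
    have hq : 1 - ‖c k‖ ^ 2 = (1 - ‖(b j : ℂ)‖ ^ 2) * (1 - ‖(b k : ℂ)‖ ^ 2) /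
        ‖1 - conj (b j : ℂ) * b k‖ ^ 2 := by
      rw [hcn, one_sub_pseudoDist_sq, norm_one_sub_conj_mul_comm]
    set aj := 1 - ‖(b j : ℂ)‖ ^ 2
    set ak := 1 - ‖(b k : ℂ)‖ ^ 2
    set D := ‖1 - conj (b j : ℂ) * b k‖
    have hlt : ‖c k‖ < 1 := hc.1 k
    have hq0 : 0 < 1 - ‖c k‖ ^ 2 := by nlinarith [norm_nonneg (c k)]
    -- the left side is `√aⱼ (1 - |cₖ|²)^(3/2) / |1 - |bⱼ| cₖ|`
    have hleft : aj * ak / D ^ 2 * √ak =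
        (1 - ‖c k‖ ^ 2) ^ (3 / 2 : ℝ) * √aj / ‖1 - (‖(b j : ℂ)‖ : ℂ) * c k‖ := by
      have h1 : (1 - ‖c k‖ ^ 2) ^ (3 / 2 : ℝ) = (1 - ‖c k‖ ^ 2) * √(1 - ‖c k‖ ^ 2) := by
        rw [Real.sqrt_eq_rpow, ← Real.rpow_one_add' hq0.le (by norm_num)]
        norm_num
      have h2 : √(1 - ‖c k‖ ^ 2) = √aj * √ak / D := by
        rw [hq, Real.sqrt_div (by positivity), Real.sqrt_sq hD.le, Real.sqrt_mul haj.le]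
      rw [h1, h2, hq, hden]
      have h3 : √aj * √aj = aj := Real.mul_self_sqrt haj.le
      field_simp
      rw [sq, h3]
    have hpow : (1 - ‖c k‖ ^ 2) ^ (3 / 2 : ℝ) ≤
        4 * (1 - t ^ 2) ^ (1 / 4 : ℝ) * (1 - ‖c k‖) ^ (5 / 4 : ℝ) := by
      have h1 : (1 - ‖c k‖ ^ 2) ^ (3 / 2 : ℝ) =
          (1 - ‖c k‖ ^ 2) ^ (1 / 4 : ℝ) * (1 - ‖c k‖ ^ 2) ^ (5 / 4 : ℝ) := by
        rw [← Real.rpow_add hq0]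
        norm_num
      have h2 : (1 - ‖c k‖ ^ 2) ^ (1 / 4 : ℝ) ≤ (1 - t ^ 2) ^ (1 / 4 : ℝ) := by
        refine Real.rpow_le_rpow hq0.le ?_ (by norm_num)
        have := hsep j k hkj
        rw [← hcn] at this
        nlinarith
      have h3 : (1 - ‖c k‖ ^ 2) ^ (5 / 4 : ℝ) ≤ 4 * (1 - ‖c k‖) ^ (5 / 4 : ℝ) := by
        calc (1 - ‖c k‖ ^ 2) ^ (5 / 4 : ℝ) ≤ (2 * (1 - ‖c k‖)) ^ (5 / 4 : ℝ) := by
              refine Real.rpow_le_rpow hq0.le ?_ (by norm_num)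
              nlinarith [norm_nonneg (c k)]
          _ = 2 ^ (5 / 4 : ℝ) * (1 - ‖c k‖) ^ (5 / 4 : ℝ) :=
              Real.mul_rpow (by norm_num) (by linarith)
          _ ≤ 4 * (1 - ‖c k‖) ^ (5 / 4 : ℝ) := by
              have h5 : (2 : ℝ) ^ (5 / 4 : ℝ) ≤ 2 ^ (2 : ℝ) :=
                Real.rpow_le_rpow_of_exponent_le (by norm_num) (by norm_num)
              have h6 : (0 : ℝ) ≤ (1 - ‖c k‖) ^ (5 / 4 : ℝ) :=
                Real.rpow_nonneg (by linarith) _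
              norm_num at h5
              gcongr
      have ht0 : 0 ≤ (1 - t ^ 2) ^ (1 / 4 : ℝ) := Real.rpow_nonneg (by nlinarith) _
      rw [h1]
      calc _ ≤ (1 - t ^ 2) ^ (1 / 4 : ℝ) * (4 * (1 - ‖c k‖) ^ (5 / 4 : ℝ)) :=
            mul_le_mul h2 h3 (Real.rpow_nonneg hq0.le _) ht0
        _ = _ := by ring
    rw [hleft]
    calc _ ≤ 4 * (1 - t ^ 2) ^ (1 / 4 : ℝ) * (1 - ‖c k‖) ^ (5 / 4 : ℝ) * √aj /
          ‖1 - (‖(b j : ℂ)‖ : ℂ) * c k‖ := by gcongr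
      _ = _ := by ring
  refine (Finset.sum_le_sum hterm).trans ?_
  rw [← Finset.mul_sum]
  have ht0 : 0 ≤ (1 - t ^ 2) ^ (1 / 4 : ℝ) := Real.rpow_nonneg (by nlinarith) _
  calc _ ≤ 4 * (1 - t ^ 2) ^ (1 / 4 : ℝ) * √(1 - ‖(b j : ℂ)‖ ^ 2) * C := by gcongr
    _ = _ := by ring

/-! ### Riesz sequences -/

/-- The weighted Schur test, in the form of a lower Riesz bound for unit vectors whose off-diagonal
Gram matrix is small. -/
theorem riesz_lower_bound {ι E : Type*} [DecidableEq ι] [NormedAddCommGroup E]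
    [InnerProductSpace ℂ E] {e : ι → E} (he : ∀ i, ‖e i‖ = 1) {w : ι → ℝ} (hw : ∀ i, 0 < w i)
    (hG : ∀ (F : Finset ι) (j : ι), ∑ k ∈ F.erase j, ‖inner ℂ (e j) (e k)‖ * w k ≤ 1 / 2 * w j)
    (F : Finset ι) (x : ι → ℂ) :
    1 / 2 * ∑ i ∈ F, ‖x i‖ ^ 2 ≤ ‖∑ i ∈ F, x i • e i‖ ^ 2 := by
  set H : ι → ι → ℝ := fun j k => if k = j then 0 else ‖inner ℂ (e j) (e k)‖ with hH
  have hH0 : ∀ j k, 0 ≤ H j k := fun j k => by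
    simp only [hH]
    split_ifs
    exacts [le_rfl, norm_nonneg _]
  have hsymm : ∀ j k, H j k = H k j := fun j k => by
    simp only [hH, eq_comm (a := k), norm_inner_symm (e j)]
  have hrow : ∀ j, ∑ k ∈ F, H j k * w k ≤ 1 / 2 * w j := fun j => by
    refine le_trans (le_of_eq ?_) (hG F j)
    rw [← Finset.filter_ne' F j, Finset.sum_filter]
    refine Finset.sum_congr rfl fun k _ => ?_
    by_cases h : k = j <;> simp [hH, h]
  have hexp : ((‖∑ i ∈ F, x i • e i‖ ^ 2 : ℝ) : ℂ) =
      ∑ j ∈ F, ∑ k ∈ F, conj (x j) * x k * inner ℂ (e j) (e k) := by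
    have := inner_self_eq_norm_sq_to_K (𝕜 := ℂ) (∑ i ∈ F, x i • e i)
    rw [sum_inner] at this
    simp only [inner_sum, inner_smul_left, inner_smul_right] at this
    rw [Complex.ofReal_pow]
    refine this.symm.trans (Finset.sum_congr rfl fun j _ => Finset.sum_congr rfl fun k _ => ?_)
    ring
  have hlow : ∀ j ∈ F, ‖x j‖ ^ 2 - ∑ k ∈ F, ‖x j‖ * ‖x k‖ * H j k ≤
      (∑ k ∈ F, conj (x j) * x k * inner ℂ (e j) (e k)).re := by
    intro j hj
    rw [← Finset.add_sum_erase F (fun k => conj (x j) * x k * inner ℂ (e j) (e k)) hj,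
      Complex.add_re, ← Finset.add_sum_erase F (fun k => ‖x j‖ * ‖x k‖ * H j k) hj]
    have h1 : (conj (x j) * x j * inner ℂ (e j) (e j)).re = ‖x j‖ ^ 2 := by
      rw [inner_self_eq_norm_sq_to_K, he, mul_comm (conj (x j)), Complex.mul_conj,
        Complex.normSq_eq_norm_sq]
      norm_num [← Complex.ofReal_pow, -Complex.ofReal_pow]
    have h2 : ‖x j‖ * ‖x j‖ * H j j = 0 := by simp [hH]
    have h3 : |(∑ k ∈ F.erase j, conj (x j) * x k * inner ℂ (e j) (e k)).re| ≤
        ∑ k ∈ F.erase j, ‖x j‖ * ‖x k‖ * H j k := by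
      refine (Complex.abs_re_le_norm _).trans ((norm_sum_le _ _).trans (le_of_eq ?_))
      refine Finset.sum_congr rfl fun k hk => ?_
      simp [hH, Finset.ne_of_mem_erase hk]
    have h4 := neg_abs_le (∑ k ∈ F.erase j, conj (x j) * x k * inner ℂ (e j) (e k)).re
    rw [h2, h1]
    linarith
  have hcross : ∑ j ∈ F, ∑ k ∈ F, ‖x j‖ * ‖x k‖ * H j k ≤ 1 / 2 * ∑ j ∈ F, ‖x j‖ ^ 2 := by
    have hterm : ∀ j k, ‖x j‖ * ‖x k‖ * H j k ≤
        1 / 2 * (‖x j‖ ^ 2 / w j * (H j k * w k)) + 1 / 2 * (‖x k‖ ^ 2 / w k * (H k j * w j)) := by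
      intro j k
      have hj := hw j
      have hk := hw k
      -- the arithmetic-geometric mean inequality, weighted by `w k / w j`
      have h1 : ‖x j‖ * ‖x k‖ ≤ 1 / 2 * (‖x j‖ ^ 2 / w j * w k + ‖x k‖ ^ 2 / w k * w j) := by
        have h2 : 1 / 2 * (‖x j‖ ^ 2 / w j * w k + ‖x k‖ ^ 2 / w k * w j) - ‖x j‖ * ‖x k‖ =
            1 / 2 * (‖x j‖ * w k - ‖x k‖ * w j) ^ 2 / (w j * w k) := by
          field_simp
          ring
        have h3 : 0 ≤ 1 / 2 * (‖x j‖ * w k - ‖x k‖ * w j) ^ 2 / (w j * w k) := by positivity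
        linarith
      rw [← hsymm j k]
      nlinarith [mul_le_mul_of_nonneg_right h1 (hH0 j k)]
    have hhalf : ∑ j ∈ F, ∑ k ∈ F, ‖x j‖ ^ 2 / w j * (H j k * w k) ≤
        1 / 2 * ∑ j ∈ F, ‖x j‖ ^ 2 := by
      rw [Finset.mul_sum]
      refine Finset.sum_le_sum fun j _ => ?_
      have hj := hw j
      rw [← Finset.mul_sum]
      calc _ ≤ ‖x j‖ ^ 2 / w j * (1 / 2 * w j) := by
            gcongr
            exact hrow j
        _ = _ := by field_simp
    calc _ ≤ ∑ j ∈ F, ∑ k ∈ F, (1 / 2 * (‖x j‖ ^ 2 / w j * (H j k * w k)) +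
          1 / 2 * (‖x k‖ ^ 2 / w k * (H k j * w j))) :=
          Finset.sum_le_sum fun j _ => Finset.sum_le_sum fun k _ => hterm j k
      _ = 1 / 2 * (∑ j ∈ F, ∑ k ∈ F, ‖x j‖ ^ 2 / w j * (H j k * w k)) +
          1 / 2 * (∑ j ∈ F, ∑ k ∈ F, ‖x j‖ ^ 2 / w j * (H j k * w k)) := by
          have hc := Finset.sum_comm (s := F) (t := F)
            (f := fun j k => 1 / 2 * (‖x k‖ ^ 2 / w k * (H k j * w j)))
          simp only [Finset.sum_add_distrib]
          rw [hc]
          simp only [Finset.mul_sum]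
      _ ≤ _ := by linarith
  have hre := congrArg Complex.re hexp
  rw [Complex.ofReal_re, Complex.re_sum] at hre
  rw [hre]
  have := Finset.sum_le_sum hlow
  rw [Finset.sum_sub_distrib] at this
  linarith

/-- If every finite subfamily satisfies a lower Riesz bound, then each vector of the family is
detected by a vector orthogonal to all the others. -/
theorem exists_orthogonal_of_riesz {ι E : Type*} [DecidableEq ι] [NormedAddCommGroup E]
    [InnerProductSpace ℂ E] [CompleteSpace E] {e : ι → E}
    (h : ∀ (F : Finset ι) (x : ι → ℂ),
      1 / 2 * ∑ i ∈ F, ‖x i‖ ^ 2 ≤ ‖∑ i ∈ F, x i • e i‖ ^ 2) (i₀ : ι) :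
    ∃ f : E, (∀ i, i ≠ i₀ → inner ℂ (e i) f = 0) ∧ inner ℂ (e i₀) f ≠ 0 := by
  set V := Submodule.span ℂ (e '' {i | i ≠ i₀}) with hV
  have hfar : ∀ v ∈ V, 1 / 2 ≤ ‖e i₀ - v‖ ^ 2 := by
    intro v hv
    obtain ⟨l, hl, rfl⟩ := (Finsupp.mem_span_image_iff_linearCombination ℂ).1 hv
    have hi₀ : i₀ ∉ l.support := fun hmem => hl hmem rfl
    have h1 := h (insert i₀ l.support) (fun i => if i = i₀ then 1 else -l i)
    rw [Finset.sum_insert hi₀, Finset.sum_insert hi₀] at h1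
    have h2 : ∑ i ∈ l.support, (if i = i₀ then (1 : ℂ) else -l i) • e i =
        -Finsupp.linearCombination ℂ e l := by
      rw [Finsupp.linearCombination_apply, Finsupp.sum, ← Finset.sum_neg_distrib]
      refine Finset.sum_congr rfl fun i hi => ?_
      have : i ≠ i₀ := fun hh => hi₀ (hh ▸ hi)
      simp [this]
    rw [h2, if_pos rfl, one_smul, ← sub_eq_add_neg, norm_one] at h1
    refine le_trans ?_ h1
    have : (0 : ℝ) ≤ ∑ i ∈ l.support, ‖if i = i₀ then (1 : ℂ) else -l i‖ ^ 2 :=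
      Finset.sum_nonneg fun i _ => by positivity
    linarith
  -- otherwise `e i₀` lies in `Vᗮᗮ`, the closure of `V`
  by_contra! hcon
  have hmem : e i₀ ∈ Vᗮᗮ := by
    rw [Submodule.mem_orthogonal]
    intro f hf
    refine inner_eq_zero_symm.1 (hcon f fun i hi => ?_)
    exact (Submodule.mem_orthogonal V f).1 hf _ (Submodule.subset_span ⟨i, hi, rfl⟩)
  rw [Submodule.orthogonal_orthogonal_eq_closure] at hmem
  obtain ⟨v, hv, hd⟩ := Metric.mem_closure_iff.1 hmem (1 / 2) (by norm_num)
  have h1 := hfar v hv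
  rw [dist_eq_norm] at hd
  nlinarith [norm_nonneg (e i₀ - v)]

/-! ### The Toeplitz operator of a separated sequence -/

theorem memlp_weight_mul_eval {b : ℕ → Disk} (hb : Separated fun k => (b k : ℂ))
    (f : BergmanSpace) :
    Memℓp (fun k => ((1 - ‖(b k : ℂ)‖ ^ 2 : ℝ) : ℂ) * eval f (b k)) 2 := by
  refine memℓp_gen' (C := 64 * ‖f‖ ^ 2) fun F => le_trans (le_of_eq ?_)
    (sum_weight_mul_eval_sq_le hb f F)
  refine Finset.sum_congr rfl fun k _ => ?_
  rw [norm_mul, Complex.norm_real, Real.norm_of_nonneg (one_sub_norm_sq_pos _).le]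
  simp

/-- The weighted restriction `f ↦ ((1 - |b k|²) f(b k))ₖ` from the Bergman space to `ℓ²`. -/
def restriction (b : ℕ → Disk) (hb : Separated fun k => (b k : ℂ)) :
    BergmanSpace →L[ℂ] lp (fun _ : ℕ => ℂ) 2 :=
  LinearMap.mkContinuous
    { toFun := fun f => ⟨_, memlp_weight_mul_eval hb f⟩
      map_add' := fun f g => by
        ext k
        simp only [eval_add, mul_add, lp.coeFn_add, Pi.add_apply]
      map_smul' := fun c f => by
        ext k
        simp only [eval_smul, lp.coeFn_smul, Pi.smul_apply, smul_eq_mul, RingHom.id_apply]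
        ring } 8 fun f => by
    refine lp.norm_le_of_forall_sum_le (by simp) (by positivity) fun F => ?_
    have h := sum_weight_mul_eval_sq_le hb f F
    simp only [ENNReal.toReal_ofNat, Real.rpow_ofNat, LinearMap.coe_mk, AddHom.coe_mk]
    refine le_trans (le_of_eq (Finset.sum_congr rfl fun k _ => ?_)) (h.trans (le_of_eq (by ring)))
    rw [norm_mul, Complex.norm_real, Real.norm_of_nonneg (one_sub_norm_sq_pos _).le]

theorem restriction_apply {b : ℕ → Disk} (hb : Separated fun k => (b k : ℂ)) (f : BergmanSpace)
    (k : ℕ) : restriction b hb f k = ((1 - ‖(b k : ℂ)‖ ^ 2 : ℝ) : ℂ) * eval f (b k) :=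
  rfl

/-- The Toeplitz operator of the lattice measure, as `S* S` for the weighted restriction `S`. -/
def latticeToeplitz (b : ℕ → Disk) (hb : Separated fun k => (b k : ℂ)) :
    BergmanSpace →L[ℂ] BergmanSpace :=
  (ContinuousLinearMap.adjoint (restriction b hb)).comp (restriction b hb)

theorem hasSum_eval_latticeToeplitz {b : ℕ → Disk} (hb : Separated fun k => (b k : ℂ))
    (f : BergmanSpace) (z : Disk) :
    HasSum (fun k => (1 - ‖(b k : ℂ)‖ ^ 2) ^ 2 •
      (eval f (b k) / (1 - (z : ℂ) * conj (b k : ℂ)) ^ 2)) (eval (latticeToeplitz b hb f) z) := by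
  have h := lp.hasSum_inner (𝕜 := ℂ) (restriction b hb (kernelElem z)) (restriction b hb f)
  rw [← ContinuousLinearMap.adjoint_inner_right] at h
  rw [← inner_kernelElem]
  convert! h using 2 with k
  rw [restriction_apply, restriction_apply, eval_kernelElem, RCLike.inner_apply, kernel,
    Complex.real_smul]
  simp only [map_mul, Complex.conj_ofReal, map_div₀, map_one, map_pow, map_sub, Complex.conj_conj]
  push_cast
  ring

theorem toReal_weight (z : Disk) :
    (ENNReal.ofReal ((1 - ‖(z : ℂ)‖ ^ 2) ^ 2)).toReal = (1 - ‖(z : ℂ)‖ ^ 2) ^ 2 :=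
  ENNReal.toReal_ofReal (sq_nonneg _)

theorem integrable_latticeMeasure {E : Type*} [NormedAddCommGroup E] {b : ℕ → Disk} {g : Disk → E}
    (hs : Summable fun k => (1 - ‖(b k : ℂ)‖ ^ 2) ^ 2 * ‖g (b k)‖) :
    Integrable g (latticeMeasure b) := by
  refine integrable_sum_dirac (fun _ => ENNReal.ofReal_ne_top) ?_
  simpa only [toReal_weight] using hs

theorem hasSum_integral_latticeMeasure {E : Type*} [NormedAddCommGroup E] [NormedSpace ℝ E]
    [CompleteSpace E] {b : ℕ → Disk} {g : Disk → E}
    (hs : Summable fun k => (1 - ‖(b k : ℂ)‖ ^ 2) ^ 2 * ‖g (b k)‖) :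
    HasSum (fun k => (1 - ‖(b k : ℂ)‖ ^ 2) ^ 2 • g (b k)) (∫ w, g w ∂latticeMeasure b) := by
  have h := hasSum_integral_sum_dirac (f := g) (x := b)
    (c := fun k => ENNReal.ofReal ((1 - ‖(b k : ℂ)‖ ^ 2) ^ 2)) (fun _ => ENNReal.ofReal_ne_top)
    (by simpa only [toReal_weight] using hs)
  simp only [toReal_weight] at h
  exact h

theorem isToeplitzOperator_latticeToeplitz {b : ℕ → Disk} (hb : Separated fun k => (b k : ℂ)) :
    IsToeplitzOperator (latticeMeasure b) (latticeToeplitz b hb) := by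
  intro f z
  have h := hasSum_eval_latticeToeplitz hb f z
  have hs : Summable fun k => (1 - ‖(b k : ℂ)‖ ^ 2) ^ 2 *
      ‖eval f (b k) / (1 - (z : ℂ) * conj (b k : ℂ)) ^ 2‖ := by
    refine h.summable.norm.congr fun k => ?_
    rw [norm_smul, Real.norm_of_nonneg (sq_nonneg _)]
  set g : Disk → ℂ := fun w => eval f w / (1 - (z : ℂ) * conj (w : ℂ)) ^ 2
  exact ⟨integrable_latticeMeasure (g := g) hs,
    h.unique (hasSum_integral_latticeMeasure (g := g) hs)⟩

/-- The masses are summable: the square sum bound for the constant function `1 = K₀`. -/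
theorem summable_weight {b : ℕ → Disk} (hb : Separated fun k => (b k : ℂ)) :
    Summable fun k => (1 - ‖(b k : ℂ)‖ ^ 2) ^ 2 := by
  have h1 : ∀ z : Disk, eval (kernelElem ⟨0, by simp⟩) z = 1 := fun z => by
    simp [eval_kernelElem, kernel]
  refine summable_of_sum_le (fun k => sq_nonneg _)
    (c := 64 * ‖kernelElem ⟨0, by simp⟩‖ ^ 2) fun F => ?_
  have h := sum_weight_mul_eval_sq_le hb (kernelElem ⟨0, by simp⟩) F
  simpa only [h1, norm_one, mul_one] using h

theorem isFiniteMeasure_latticeMeasure {b : ℕ → Disk} (hb : Separated fun k => (b k : ℂ)) :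
    IsFiniteMeasure (latticeMeasure b) := by
  have h : Integrable (fun _ : Disk => (1 : ℝ)) (latticeMeasure b) := by
    refine integrable_latticeMeasure ?_
    simpa only [norm_one, mul_one] using summable_weight hb
  exact (integrable_const_iff_isFiniteMeasure one_ne_zero).1 h

/-- A single point of the sequence already contributes `(1 - ρ²)²` to the Berezin transform. -/
theorem le_berezin_latticeMeasure {b : ℕ → Disk} (hb : Separated fun k => (b k : ℂ)) (z : Disk)
    (k : ℕ) : (1 - pseudoDist (b k) z ^ 2) ^ 2 ≤ berezin (latticeMeasure b) z := by
  have hz := one_sub_norm_sq_pos z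
  have hs : Summable fun k => (1 - ‖(b k : ℂ)‖ ^ 2) ^ 2 * ‖‖normalizedKernel z (b k)‖ ^ 2‖ := by
    refine Summable.of_nonneg_of_le (fun k => by positivity) (fun k => ?_)
      ((summable_weight hb).mul_right ((1 - ‖(z : ℂ)‖ ^ 2) ^ 2 / (1 - ‖(z : ℂ)‖) ^ 4))
    have h1 := one_sub_norm_le z (norm_coe_lt_one (b k)).le
    have h0 : 0 < 1 - ‖(z : ℂ)‖ := by linarith [norm_coe_lt_one z]
    rw [Real.norm_of_nonneg (sq_nonneg _), norm_normalizedKernel_sq]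
    gcongr
  have h := hasSum_integral_latticeMeasure (g := fun w : Disk => ‖normalizedKernel z w‖ ^ 2) hs
  refine le_trans (le_of_eq ?_)
    (le_hasSum h k fun j _ => mul_nonneg (sq_nonneg _) (sq_nonneg _))
  rw [smul_eq_mul, one_sub_pseudoDist_sq, norm_normalizedKernel_sq]
  ring

/-! ### Failure of injectivity for sparse sequences -/

theorem inner_smul_kernelElem_left (c : ℂ) (z : Disk) (f : BergmanSpace) :
    inner ℂ (c • kernelElem z) f = conj c * eval f z := by
  rw [← inner_kernelElem]
  exact inner_smul_left (𝕜 := ℂ) (kernelElem z) f c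

theorem inner_smul_kernelElem (b : ℕ → Disk) (j k : ℕ) :
    ‖inner ℂ (((1 - ‖(b j : ℂ)‖ ^ 2 : ℝ) : ℂ) • kernelElem (b j))
      (((1 - ‖(b k : ℂ)‖ ^ 2 : ℝ) : ℂ) • kernelElem (b k))‖ =
    (1 - ‖(b j : ℂ)‖ ^ 2) * (1 - ‖(b k : ℂ)‖ ^ 2) / ‖1 - conj (b j : ℂ) * b k‖ ^ 2 := by
  rw [inner_smul_kernelElem_left, eval_smul, eval_kernelElem, kernel, norm_mul,
    norm_mul, norm_div, norm_pow, norm_one, RCLike.norm_conj, Complex.norm_real,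
    Complex.norm_real, Real.norm_of_nonneg (one_sub_norm_sq_pos _).le,
    Real.norm_of_nonneg (one_sub_norm_sq_pos _).le, norm_one_sub_conj_mul_comm]
  ring

/-- For sufficiently large separation the normalized kernels form a Riesz sequence; hence some
Bergman function vanishes at all points but one. -/
theorem exists_eval_eq_zero_off_point : ∃ t₀ : ℝ, 1 / 2 ≤ t₀ ∧ t₀ < 1 ∧ ∀ b : ℕ → Disk,
    (∀ i j, i ≠ j → t₀ ≤ pseudoDist (b i) (b j)) →
      ∃ f : BergmanSpace, (∀ k, k ≠ 0 → eval f (b k) = 0) ∧ eval f (b 0) ≠ 0 := by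
  obtain ⟨C, hC, h⟩ := exists_gram_schur_bound
  have hlim : Tendsto (fun t : ℝ => C * (1 - t ^ 2) ^ (1 / 4 : ℝ)) (𝓝[<] 1) (𝓝 0) := by
    have hc : Continuous fun t : ℝ => C * (1 - t ^ 2) ^ (1 / 4 : ℝ) :=
      continuous_const.mul (((continuous_const.sub (continuous_id.pow 2))).rpow_const
        fun _ => Or.inr (by norm_num))
    have := (hc.tendsto 1).mono_left (nhdsWithin_le_nhds (s := Iio 1))
    simpa [Real.zero_rpow] using this
  obtain ⟨t, hsmall, ht, ht1⟩ := ((hlim.eventually (gt_mem_nhds (show (0 : ℝ) < 1 / 2 by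
    norm_num))).and (Ioo_mem_nhdsLT (show (1 / 2 : ℝ) < 1 by norm_num))).exists
  refine ⟨t, ht.le, ht1, fun b hb => ?_⟩
  set e : ℕ → BergmanSpace := fun k => ((1 - ‖(b k : ℂ)‖ ^ 2 : ℝ) : ℂ) • kernelElem (b k) with he
  have hunit : ∀ k, ‖e k‖ = 1 := fun k => by
    have hk := one_sub_norm_sq_pos (b k)
    rw [← sq_eq_sq₀ (norm_nonneg _) zero_le_one, norm_smul, mul_pow, norm_kernelElem_sq,
      Complex.norm_real, Real.norm_of_nonneg hk.le]
    field_simp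
  have hgram : ∀ (F : Finset ℕ) (j : ℕ), ∑ k ∈ F.erase j, ‖inner ℂ (e j) (e k)‖ *
      √(1 - ‖(b k : ℂ)‖ ^ 2) ≤ 1 / 2 * √(1 - ‖(b j : ℂ)‖ ^ 2) := fun F j => by
    simp only [he, inner_smul_kernelElem]
    refine (h b t ht.le ht1 hb F j).trans ?_
    gcongr
  obtain ⟨f, hf0, hf1⟩ := exists_orthogonal_of_riesz (riesz_lower_bound hunit
    (fun k => Real.sqrt_pos.2 (one_sub_norm_sq_pos (b k))) hgram) 0
  simp only [he, inner_smul_kernelElem_left] at hf0 hf1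
  refine ⟨f, fun k hk => (mul_eq_zero.1 (hf0 k hk)).resolve_left ?_, right_ne_zero_of_mul hf1⟩
  rw [Complex.conj_ofReal]
  exact_mod_cast (one_sub_norm_sq_pos (b k)).ne'

/-- Multiplying by `z - b₀` a function which vanishes at all other points gives a nonzero element
of the kernel of the Toeplitz operator. -/
theorem not_isUnit_latticeToeplitz {b : ℕ → Disk} (hb : Separated fun k => (b k : ℂ))
    {f : BergmanSpace} (h0 : ∀ k, k ≠ 0 → eval f (b k) = 0) (h1 : eval f (b 0) ≠ 0) :
    ¬ IsUnit (latticeToeplitz b hb) := by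
  intro hunit
  have hdiff : DifferentiableOn ℂ (fun w => (w - b 0) * rep f w) (ball 0 1) :=
    (differentiableOn_id.sub (differentiableOn_const _)).mul (differentiableOn_rep f)
  have hmem : MemLp (fun w => (w - b 0) * rep f w) 2 areaMeasure := by
    refine (memLp_rep f).of_le_mul (c := 2) (aestronglyMeasurable_of_differentiableOn hdiff) ?_
    filter_upwards [ae_areaMeasure_mem_ball] with w hw
    have hw1 : ‖w‖ < 1 := mem_ball_zero_iff.1 hw
    rw [norm_mul]
    gcongr
    linarith [norm_sub_le w (b 0 : ℂ), norm_coe_lt_one (b 0)]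
  set g := ofAnalytic _ hdiff hmem with hg
  have hgz : ∀ z : Disk, eval g z = (z - b 0) * eval f z := fun z => eval_ofAnalytic _ _ z
  have hgb : ∀ k, eval g (b k) = 0 := fun k => by
    rw [hgz]
    by_cases hk : k = 0
    · rw [hk, sub_self, zero_mul]
    · rw [h0 k hk, mul_zero]
  have hTg : latticeToeplitz b hb g = 0 := by
    refine ext_eval fun z => ?_
    have := hasSum_eval_latticeToeplitz hb g z
    simp only [hgb, zero_div, smul_zero] at this
    rw [eval_zero]
    exact this.unique hasSum_zero
  have hg0 : g = 0 := by
    obtain ⟨u, hu⟩ := hunit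
    have h2 : (↑u⁻¹ * ↑u : BergmanSpace →L[ℂ] BergmanSpace) g = 0 := by
      rw [hu, mul_apply_eq_comp, hTg, map_zero]
    simpa using h2
  -- `f` vanishes off the null set `{b 0}`, hence everywhere
  refine h1 (eval_eq f (g := 0) (differentiableOn_const 0) ?_ (b 0))
  have hne : ∀ᵐ w ∂areaMeasure, w ≠ (b 0 : ℂ) :=
    Measure.ae_smul_measure (ae_restrict_of_ae (Measure.ae_ne volume _)) _
  filter_upwards [coe_ae_eq_rep f, ae_areaMeasure_mem_ball, hne] with w hfw hw hwb
  have h3 := hgz ⟨w, hw⟩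
  rw [hg0, eval_zero] at h3
  rw [hfw]
  exact (mul_eq_zero.1 h3.symm).resolve_left (sub_ne_zero.2 hwb)

/-! ### Existence of lattices -/

theorem bergmanDist_lt_iff {R : ℝ} {z w : Disk} :
    bergmanDist z w < R ↔ pseudoDist z w < Real.tanh R := by
  rw [bergmanDist, ← Real.artanh_lt_artanh_iff
    ⟨by linarith [pseudoDist_nonneg z w], pseudoDist_lt_one z w⟩
    ⟨Real.neg_one_lt_tanh R, Real.tanh_lt_one R⟩, Real.artanh_tanh]

theorem le_bergmanDist_iff {R : ℝ} {z w : Disk} :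
    R ≤ bergmanDist z w ↔ Real.tanh R ≤ pseudoDist z w := by
  rw [← not_lt, bergmanDist_lt_iff, not_lt]

/-- Near the boundary of the disk there are points far from any given finite set. -/
theorem exists_forall_pseudoDist_gt {S : Set Disk} (hS : S.Finite) {t : ℝ} (ht0 : 0 ≤ t)
    (ht1 : t < 1) : ∃ z : Disk, ∀ p ∈ S, t < pseudoDist p z := by
  have hev : ∀ p ∈ S, ∀ᶠ x : ℝ in 𝓝[<] 1,
      1 - x ^ 2 < (1 - t ^ 2) * (1 - ‖(p : ℂ)‖) ^ 2 := by
    intro p _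
    have hpos : 0 < (1 - t ^ 2) * (1 - ‖(p : ℂ)‖) ^ 2 :=
      mul_pos (by nlinarith) (pow_pos (by linarith [norm_coe_lt_one p]) 2)
    have hlim : Tendsto (fun x : ℝ => 1 - x ^ 2) (𝓝[<] 1) (𝓝 0) := by
      have := ((continuous_const.sub (continuous_id.pow 2) :
        Continuous fun x : ℝ => 1 - x ^ 2).tendsto 1).mono_left (nhdsWithin_le_nhds (s := Iio 1))
      simpa using! this
    exact hlim.eventually (gt_mem_nhds hpos)
  obtain ⟨x, hx, hx0, hx1⟩ := (((hS.eventually_all).2 hev).and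
    (Ioo_mem_nhdsLT (show (0 : ℝ) < 1 by norm_num))).exists
  have hnorm : ‖(x : ℂ)‖ = x := by rw [Complex.norm_real, Real.norm_of_nonneg hx0.le]
  refine ⟨⟨(x : ℂ), mem_ball_zero_iff.2 (by rwa [hnorm])⟩, fun p hp => ?_⟩
  set z : Disk := ⟨(x : ℂ), mem_ball_zero_iff.2 (by rwa [hnorm])⟩ with hz
  have h1 := one_sub_pseudoDist_sq p z
  have hzn : ‖(z : ℂ)‖ = x := hnorm
  have hp0 : 0 < 1 - ‖(p : ℂ)‖ := by linarith [norm_coe_lt_one p]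
  have h2 := one_sub_norm_le p (norm_coe_lt_one z).le
  rw [norm_one_sub_conj_mul_comm] at h1
  have h3 : 1 - pseudoDist p z ^ 2 < 1 - t ^ 2 := by
    rw [h1, hzn, div_lt_iff₀ (pow_pos (hp0.trans_le h2) 2)]
    have h4 : (1 - ‖(p : ℂ)‖) ^ 2 ≤ ‖1 - conj (p : ℂ) * z‖ ^ 2 := by gcongr
    have h5 : 0 < 1 - t ^ 2 := by nlinarith
    nlinarith [hx p hp, sq_nonneg ‖(p : ℂ)‖, mul_le_mul_of_nonneg_left h4 h5.le,
      mul_pos (sub_pos.2 hx1) hx0]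
  nlinarith [pseudoDist_nonneg p z]

/-- A maximal family of points with mutual Bergman distances at least `R / 2` is a lattice. -/
theorem exists_isLattice {R : ℝ} (hR : 0 < R) (hR' : 1 / 2 ≤ Real.tanh (R / 2)) :
    ∃ b : ℕ → Disk, IsLattice R b := by
  obtain ⟨S, hS⟩ := zorn_subset {S : Set Disk | S.Pairwise fun z w => R / 2 ≤ bergmanDist z w}
    fun c hc hchain => ⟨⋃₀ c, (pairwise_sUnion hchain.directedOn).2 hc,
      fun s hs => subset_sUnion_of_mem hs⟩
  have hsep := hS.prop
  have hcover : ∀ z : Disk, ∃ p ∈ S, bergmanDist p z < R := by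
    intro z
    by_contra! hcon
    have hins : (insert z S).Pairwise fun z w => R / 2 ≤ bergmanDist z w := by
      have hp : ∀ p ∈ S, R / 2 ≤ bergmanDist p z := fun p hp => by linarith [hcon p hp]
      refine pairwise_insert.2 ⟨hsep, fun p hpS _ => ⟨?_, hp p hpS⟩⟩
      rw [bergmanDist, pseudoDist_comm]
      exact hp p hpS
    have hzS : z ∈ S := hS.le_of_ge hins (subset_insert z S) (mem_insert z S)
    have h0 := hcon z hzS
    rw [bergmanDist, pseudoDist, sub_self, zero_div, norm_zero, Real.artanh_zero] at h0
    linarith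
  have hcount : S.Countable := by
    refine PairwiseDisjoint.countable_of_isOpen
      (s := fun p : Disk => {w : Disk | (w : ℂ) ∈ ball (p : ℂ) ((1 - ‖(p : ℂ)‖) / 4)})
      ?_ (fun p _ => isOpen_ball.preimage continuous_subtype_val)
      fun p _ => ⟨p, mem_ball_self (by linarith [norm_coe_lt_one p])⟩
    intro p hp q hq hpq
    have hd : ‖1 - conj (p : ℂ) * q‖ ≤ 2 * ‖(q : ℂ) - p‖ := by
      have h1 := hR'.trans (le_bergmanDist_iff.1 (hsep hp hq hpq))
      have h2 := norm_one_sub_conj_mul_pos p q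
      rw [pseudoDist, norm_div, le_div_iff₀ h2] at h1
      rw [norm_one_sub_conj_mul_comm]
      linarith
    exact (disjoint_ball_of_separated (norm_coe_lt_one p) (norm_coe_lt_one q) hd).preimage _
  have htanh : 0 < Real.tanh R := by
    rw [Real.tanh_eq_sinh_div_cosh]
    exact div_pos (Real.sinh_pos_iff.2 hR) (Real.cosh_pos R)
  -- a finite family would leave points near the boundary uncovered
  have hinf : S.Infinite := by
    intro hfin
    obtain ⟨z, hz⟩ := exists_forall_pseudoDist_gt hfin
      htanh.le (Real.tanh_lt_one R)
    obtain ⟨p, hp, hpz⟩ := hcover z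
    exact lt_asymm (hz p hp) (bergmanDist_lt_iff.1 hpz)
  have := hcount.to_subtype
  have := hinf.to_subtype
  obtain ⟨_⟩ := nonempty_denumerable S
  let φ : ℕ ≃ S := (Denumerable.eqv S).symm
  refine ⟨fun k => φ k, Subtype.val_injective.comp φ.injective, fun z => ?_, fun j k hjk => ?_⟩
  · obtain ⟨p, hp, hpz⟩ := hcover z
    exact ⟨φ.symm ⟨p, hp⟩, by simpa using hpz⟩
  · exact hsep (φ k).2 (φ j).2 fun h => hjk (φ.injective (Subtype.ext h)).symm

end Bergman

end

theorem mainTheorem1 :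
    (∃ ν : MeasureTheory.Measure Bergman.Disk, Bergman.IsDouglasCounterexample ν) ∧
    ∃ R₀ : ℝ, 0 < R₀ ∧ ∀ R : ℝ, R₀ ≤ R →
      (∃ b : ℕ → Bergman.Disk, Bergman.IsLattice R b) ∧
      ∀ b : ℕ → Bergman.Disk, Bergman.IsLattice R b →
        Bergman.IsDouglasCounterexample (Bergman.latticeMeasure b) := by
  obtain ⟨t, ht, ht1, h⟩ := Bergman.exists_eval_eq_zero_off_point
  suffices hmain : ∃ R₀ : ℝ, 0 < R₀ ∧ ∀ R : ℝ, R₀ ≤ R →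
      (∃ b : ℕ → Bergman.Disk, Bergman.IsLattice R b) ∧
      ∀ b : ℕ → Bergman.Disk, Bergman.IsLattice R b →
        Bergman.IsDouglasCounterexample (Bergman.latticeMeasure b) by
    refine ⟨?_, hmain⟩
    obtain ⟨R₀, _, hR₀⟩ := hmain
    obtain ⟨⟨b, hb⟩, hall⟩ := hR₀ R₀ le_rfl
    exact ⟨_, hall b hb⟩
  have htpos : 0 < Real.artanh t := Real.artanh_pos ⟨by linarith, ht1⟩
  refine ⟨2 * Real.artanh t, by positivity, fun R hR => ?_⟩
  have htR : t ≤ Real.tanh (R / 2) := by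
    have h1 : Real.artanh t ≤ Real.artanh (Real.tanh (R / 2)) := by
      rw [Real.artanh_tanh]
      linarith
    exact (Real.artanh_le_artanh_iff ⟨by linarith, ht1⟩
      ⟨Real.neg_one_lt_tanh _, Real.tanh_lt_one _⟩).1 h1
  refine ⟨Bergman.exists_isLattice (by linarith) (ht.trans htR), fun b hb => ?_⟩
  obtain ⟨-, hcover, hdist⟩ := hb
  have hfar : ∀ i j, i ≠ j → t ≤ Bergman.pseudoDist (b i) (b j) := fun i j hij =>
    htR.trans (Bergman.le_bergmanDist_iff.1 (hdist j i hij.symm))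
  have hsep := Bergman.separated_of_pseudoDist fun i j hij => ht.trans (hfar i j hij)
  obtain ⟨f, hf0, hf1⟩ := h b hfar
  refine ⟨Bergman.isFiniteMeasure_latticeMeasure hsep,
    ⟨_, Bergman.isToeplitzOperator_latticeToeplitz hsep,
      Bergman.not_isUnit_latticeToeplitz hsep hf0 hf1⟩,
    (1 - Real.tanh R ^ 2) ^ 2, ?_, fun z => ?_⟩
  · have h1 := Real.tanh_lt_one R
    have h2 := Real.neg_one_lt_tanh R
    have : 0 < 1 - Real.tanh R ^ 2 := by nlinarith
    positivity
  · obtain ⟨k, hk⟩ := hcover z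
    refine le_trans ?_ (Bergman.le_berezin_latticeMeasure hsep z k)
    have h1 := Bergman.bergmanDist_lt_iff.1 hk
    have h2 := Real.tanh_lt_one R
    have h3 := Bergman.pseudoDist_nonneg (b k) z
    have h4 : Bergman.pseudoDist (b k) z ^ 2 ≤ Real.tanh R ^ 2 := by gcongr
    have h5 : 0 ≤ 1 - Real.tanh R ^ 2 := by nlinarith
    gcongr
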